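/- For finite graphs $F,G$ let $P(F,G)$ be the number of $|V(F)|$-subsets of $V(G)$ that induce a subgraph isomorphic to $F$, and let $p(F,G)=P(F,G)/\binom{|V(G)|}{|V(F)|}$. Let $i(F)=\lim_{n\to\infty}i(F,n)$, where $i(F,n)$ is the maximum of $p(F,G)$ over all $n$-vertex graphs $G$, and let $i_k(F)=\lim_{n\to\infty}i_k(F,n)$, where $i_k(F,n)$ is the maximum of $p(F,G)$ over all $n$-vertex graphs $G$ containing no $K_k$. A graphon is a symmetric measurable function $W:[0,1]^2\to\{0,1\}$; the induced density of $F$ in $W$ is the probability that $|V(F)|$ independent uniformly random points of $[0,1]$ induce a copy of $F$, where distinct points $u,v$ are adjacent if and only if $W(u,v)=1$. We say that $W$ attains $i(F)$ if its induced density of $F$ is $i(F)$, and that $W$ attains $i_k(F)$ if $W$ contains no $K_k$ (there are no $k$ distinct pairwise adjacent points) and its induced density of $F$ is $i_k(F)$. A complete $t$-partite graphon is a graphon $W[x_1,\dots,x_t]$ with $x_1,\dots,x_t>0$ and $x_1+\dots+x_t=1$, which is defined by partitioning $[0,1]$ into consecutive intervals of lengths $x_1,\dots,x_t$ and setting $W(x,y)=1$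 if and only if $x$ and $y$ lie in distinct intervals. A graph $F$ is inducibility diverse if for every $k\in\mathbb N$ there is $m>k$ with $i_k(F)<i_m(F)$. **Theorem.** Let $r\ge 2$, let $a_1\ge a_2\ge\dots\ge a_r\ge 1$ be integers with $a_{r-1}>1$, and let $F=K_{a_1,\dots,a_r}$ be the complete $r$-partite graph with these part sizes. Then there is $t=t(F)$ such that for every $k>t$, $i_k(F)$ is attained by a complete $t$-partite graphon, and $i(F)$ is also attained by a complete $t$-partite graphon. Moreover, $F$ is not inducibility diverse. -/

import Mathlib

open Filter Topology MeasureTheory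
open scoped unitInterval

namespace Inducibility

noncomputable section

open scoped Classical in
/-- `P(F, G)`: the number of `|V(F)|`-subsets of `V(G)` that induce a subgraph of `G` isomorphic
to `F`. -/
def inducedCount {V U : Type*} [Fintype V] [Fintype U]
    (F : SimpleGraph V) (G : SimpleGraph U) : ℕ :=
  (((Finset.univ : Finset U).powersetCard (Fintype.card V)).filter
    (fun S => Nonempty (G.induce (S : Set U) ≃g F))).card

/-- `p(F, G) = P(F, G) / binom(|V(G)|, |V(F)|)`: the induced density of `F` in `G`. -/
def inducedDensity {V U : Type*} [Fintype V] [Fintype U]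
    (F : SimpleGraph V) (G : SimpleGraph U) : ℝ :=
  (inducedCount F G : ℝ) / ((Fintype.card U).choose (Fintype.card V) : ℝ)

/-- `i(F, n)`: the maximum of `p(F, G)` over all graphs `G` with `n` vertices
(a supremum over a finite nonempty set). -/
def maxDensity {V : Type*} [Fintype V] (F : SimpleGraph V) (n : ℕ) : ℝ :=
  ⨆ G : SimpleGraph (Fin n), inducedDensity F G

/-- `i_H(F, n)`: the maximum of `p(F, G)` over all `H`-free graphs `G` with `n` vertices, where
`H`-free means that `G` has no (not necessarily induced) subgraph isomorphic to `H`. It is a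
supremum over a finite set, nonempty as soon as `H` has an edge or more than `n` vertices. -/
def maxDensityFree {V T : Type*} [Fintype V] (H : SimpleGraph T) (F : SimpleGraph V)
    (n : ℕ) : ℝ :=
  ⨆ G : {G : SimpleGraph (Fin n) // H.Free G}, inducedDensity F G.1

/-- `i_k(F, n) = i_{K_k}(F, n)`. -/
def maxDensityCliqueFree {V : Type*} [Fintype V] (k : ℕ) (F : SimpleGraph V) (n : ℕ) : ℝ :=
  maxDensityFree (SimpleGraph.completeGraph (Fin k)) F n

/-- `i_k(F)`: the limit of `i_k(F, n)` as `n → ∞` (it exists because the sequence is bounded and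
nonincreasing for `n ≥ |V(F)|`). -/
def cliqueFreeInducibility {V : Type*} [Fintype V] (k : ℕ) (F : SimpleGraph V) : ℝ :=
  limUnder atTop (maxDensityCliqueFree k F)

/-- `F` is inducibility diverse: for all `k` there is `m > k` with `i_k(F) < i_m(F)`. -/
def InducibilityDiverse {V : Type*} [Fintype V] (F : SimpleGraph V) : Prop :=
  ∀ k : ℕ, ∃ m : ℕ, k < m ∧ cliqueFreeInducibility k F < cliqueFreeInducibility m F

/-- A graphon: a symmetric measurable function `[0,1]² → {0,1}`. -/
structure Graphon where
  toFun : I → I → Fin 2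
  symm : ∀ x y, toFun x y = toFun y x
  measurable : Measurable (Function.uncurry toFun)

/-- The graph induced in `W` by a family of points of `[0,1]`: distinct `u, v` are adjacent if and
only if `W` takes the value `1` at the corresponding pair of points. -/
def Graphon.sample (W : Graphon) {V : Type*} (p : V → I) : SimpleGraph V where
  Adj u v := u ≠ v ∧ W.toFun (p u) (p v) = 1
  symm := ⟨fun _ _ h => ⟨h.1.symm, by rw [W.symm]; exact h.2⟩⟩
  loopless := ⟨fun _ h => h.1 rfl⟩

/-- The induced density of `F` in `W`: the probability that `|V(F)|` independent uniformly random
points of `[0,1]` (almost surely distinct) induce a copy of `F` in `W`. -/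
def Graphon.density {V : Type*} [Fintype V] (W : Graphon) (F : SimpleGraph V) : ℝ :=
  (volume {p : V → I | Nonempty (W.sample p ≃g F)}).toReal

/-- `W` is `H`-free: no choice of distinct points of `[0,1]` for the vertices of `H` turns all
edges of `H` into edges of `W`. -/
def Graphon.IsFree {T : Type*} (W : Graphon) (H : SimpleGraph T) : Prop :=
  ¬ ∃ p : T ↪ I, ∀ u v, H.Adj u v → W.toFun (p u) (p v) = 1

/-- `W` attains `i(F)`: the sequence `i(F, n)` converges to the induced density of `F` in `W`. -/
def Graphon.Attains {V : Type*} [Fintype V] (W : Graphon) (F : SimpleGraph V) : Prop :=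
  Tendsto (maxDensity F) atTop (𝓝 (W.density F))

/-- `W` attains `i_k(F)`: `W` is `K_k`-free and the sequence `i_k(F, n)` converges to the induced
density of `F` in `W`. -/
def Graphon.AttainsCliqueFree {V : Type*} [Fintype V] (W : Graphon) (k : ℕ)
    (F : SimpleGraph V) : Prop :=
  W.IsFree (SimpleGraph.completeGraph (Fin k)) ∧
    Tendsto (maxDensityCliqueFree k F) atTop (𝓝 (W.density F))

/-- The partition of `[0,1]` into consecutive intervals of lengths `x 0, …, x (l - 1)`, given by the
index of the interval that contains the point `y`, i.e. the number of `j < l - 1` with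
`x 0 + ⋯ + x j ≤ y`. -/
def intervalIndex {l : ℕ} (x : Fin l → ℝ) (y : I) : ℕ :=
  ((Finset.univ : Finset (Fin l)).filter
    (fun j : Fin l => (j : ℕ) + 1 < l ∧ ∑ i ∈ Finset.Iic j, x i ≤ (y : ℝ))).card

theorem measurable_intervalIndex {l : ℕ} (x : Fin l → ℝ) : Measurable (intervalIndex x) := by
  unfold intervalIndex
  simp only [Finset.card_filter]
  refine Finset.measurable_sum _ fun j _ => Measurable.ite ?_ measurable_const measurable_const
  exact (MeasurableSet.const _).inter (measurableSet_le measurable_const measurable_subtype_coe)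

/-- The complete partite graphon `W[x 0, …, x (l - 1)]`: its value is `1` exactly at the pairs of
points that lie in distinct intervals. -/
def completePartiteGraphon {l : ℕ} (x : Fin l → ℝ) : Graphon where
  toFun y z := if intervalIndex x y = intervalIndex x z then 0 else 1
  symm y z := by simp only [eq_comm]
  measurable := by
    refine Measurable.ite ?_ measurable_const measurable_const
    exact measurableSet_eq_fun ((measurable_intervalIndex x).comp measurable_fst)
      ((measurable_intervalIndex x).comp measurable_snd)

/-- `W` is a complete `l`-partite graphon: `W = W[x 0, …, x (l - 1)]` for a point of the standard
simplex, with all `l` parts of positive size. -/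
def Graphon.IsCompletePartite (W : Graphon) (l : ℕ) : Prop :=
  ∃ x ∈ stdSimplex ℝ (Fin l), (∀ i, 0 < x i) ∧ W = completePartiteGraphon x

/-- `K_{a_1, …, a_r}`: the complete `r`-partite graph with part sizes `a 0, …, a (r - 1)`. -/
abbrev completePartite {r : ℕ} (a : Fin r → ℕ) : SimpleGraph (Σ i : Fin r, Fin (a i)) :=
  SimpleGraph.completeMultipartiteGraph fun i => Fin (a i)

end

end Inducibility

/-! In a complete partite graphon with part sizes `x`, the density of $K_{a_1,\dots,a_r}$ is a fixed
multiple of `injSum a x`, the sum over injective placements $f$ of the products $\prod_l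
x_{f(l)}^{a_l}$. The heart of the proof is that merging two small parts of sizes $y\le z$ does not
decrease this sum (`injSum_le_merge`). Write $b=a_{r-1}\ge 2$. Placing that part of $F$ in the
merged part gains at least $yz^{b-1}$ times nearly the whole sum. Only placements using both parts
are lost; as two parts of $F$ have at least $b+1$ vertices together, they weigh $O(yz^b)$. So the
gain wins once $z$ is small.

A partition with many parts has two small ones, so the supremum over all finite partitions is
attained on a simplex of bounded dimension, by compactness (`exists_optimal_partition`).

This optimum governs the graph problem too. Zykov symmetrization (`exists_coloring_mapCount_le`)
bounds every graph by a complete multipartite one, and a random colouring with law `x`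
(`exists_coloring_partDensity_le`) gives matching graphs with no $K_k$ for every $k>t$. Hence
$i_k(F)=i(F)$ for all $k>t$, which rules out diversity. -/

namespace Inducibility

/-! ### Merging two small parts does not decrease the injective sum. -/

section InjectiveSum

open scoped Classical

variable {R ι : Type*} [Fintype R] [Fintype ι]

/-- The weight of an assignment `f` of the parts of `K_a` to the parts of a weighted complete
partite graph. -/
noncomputable def assignWeight (a : R → ℕ) (x : ι → ℝ) (f : R → ι) : ℝ := ∏ l, x (f l) ^ a l

/-- The sum of the weights of all injective assignments. -/
noncomputable def injSum (a : R → ℕ) (x : ι → ℝ) : ℝ :=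
  ∑ f : R → ι with Function.Injective f, assignWeight a x f

omit [Fintype ι] in
theorem assignWeight_nonneg {a : R → ℕ} {x : ι → ℝ} (hx : ∀ i, 0 ≤ x i) (f : R → ι) :
    0 ≤ assignWeight a x f :=
  Finset.prod_nonneg fun _ _ => pow_nonneg (hx _) _

theorem sum_pow_le_one {x : ι → ℝ} (hx : x ∈ stdSimplex ℝ ι) {n : ℕ} (hn : 1 ≤ n)
    (s : Finset ι) : ∑ q ∈ s, x q ^ n ≤ 1 := by
  calc ∑ q ∈ s, x q ^ n ≤ ∑ q, x q ^ n :=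
        Finset.sum_le_sum_of_subset_of_nonneg (Finset.subset_univ _)
          fun q _ _ => pow_nonneg (hx.1 q) _
    _ ≤ ∑ q, x q := by
        refine Finset.sum_le_sum fun q _ => ?_
        exact pow_le_of_le_one (hx.1 q)
          ((Finset.single_le_sum (fun i _ => hx.1 i) (Finset.mem_univ q)).trans hx.2.le) (by omega)
    _ = 1 := hx.2

omit [Fintype ι] in
theorem sum_assignWeight_piFinset (a : R → ℕ) (x : ι → ℝ) (A : R → Finset ι) :
    ∑ f ∈ Fintype.piFinset A, assignWeight a x f = ∏ l, ∑ q ∈ A l, x q ^ a l :=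
  (Finset.prod_univ_sum A fun l q => x q ^ a l).symm

/-- The sum factorises over the parts of $F$, and each free part contributes $\sum_q x_q^{a_l}\le
1$. -/
theorem sum_assignWeight_le_prod {a : R → ℕ} (ha : ∀ l, 1 ≤ a l) {x : ι → ℝ}
    (hx : x ∈ stdSimplex ℝ ι) (s : Finset R) (φ : R → ι) :
    ∑ f : R → ι with ∀ l ∈ s, f l = φ l, assignWeight a x f ≤ ∏ l ∈ s, x (φ l) ^ a l := by
  have h : (Finset.univ.filter fun f : R → ι => ∀ l ∈ s, f l = φ l)
      = Fintype.piFinset fun l => if l ∈ s then {φ l} else Finset.univ := by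
    ext f
    simp only [Finset.mem_filter, Finset.mem_univ, true_and, Fintype.mem_piFinset]
    refine forall_congr' fun l => ?_
    by_cases hl : l ∈ s <;> simp [hl]
  rw [h, sum_assignWeight_piFinset, ← Finset.prod_sdiff (Finset.subset_univ s)]
  have h1 : ∏ l ∈ s, ∑ q ∈ (if l ∈ s then {φ l} else Finset.univ), x q ^ a l
      = ∏ l ∈ s, x (φ l) ^ a l :=
    Finset.prod_congr rfl fun l hl => by simp [hl]
  rw [h1]
  refine mul_le_of_le_one_left (Finset.prod_nonneg fun l _ => pow_nonneg (hx.1 _) _) ?_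
  refine Finset.prod_le_one (fun l _ => Finset.sum_nonneg fun q _ => pow_nonneg (hx.1 _) _)
    fun l _ => sum_pow_le_one hx (ha l) _

theorem sum_filter_exists_le {α β : Type*} [Fintype α] [Fintype β] (P : β → α → Prop)
    [∀ p, DecidablePred (P p)] [DecidablePred fun f => ∃ p, P p f] {w : α → ℝ}
    (hw : ∀ f, 0 ≤ w f) :
    ∑ f with ∃ p, P p f, w f ≤ ∑ p, ∑ f with P p f, w f := by
  simp only [Finset.sum_filter]
  rw [Finset.sum_comm]
  refine Finset.sum_le_sum fun f _ => ?_
  have h0 : ∀ p ∈ (Finset.univ : Finset β), 0 ≤ if P p f then w f else 0 := fun p _ => by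
    split_ifs
    exacts [hw f, le_rfl]
  split_ifs with h
  · obtain ⟨p, hp⟩ := h
    calc w f = if P p f then w f else 0 := by simp [hp]
      _ ≤ _ := Finset.single_le_sum h0 (Finset.mem_univ p)
  · exact Finset.sum_nonneg h0

theorem sum_le_sum_of_injOn {α β : Type*} {s : Finset α} {t : Finset β} {w : α → ℝ} {v : β → ℝ}
    (e : α → β) (hmaps : ∀ p ∈ s, e p ∈ t) (hinj : Set.InjOn e s) (hle : ∀ p ∈ s, w p ≤ v (e p))
    (hv : ∀ q ∈ t, 0 ≤ v q) : ∑ p ∈ s, w p ≤ ∑ q ∈ t, v q := by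
  calc ∑ p ∈ s, w p ≤ ∑ p ∈ s, v (e p) := Finset.sum_le_sum hle
    _ = ∑ q ∈ s.image e, v q := (Finset.sum_image hinj).symm
    _ ≤ ∑ q ∈ t, v q := Finset.sum_le_sum_of_subset_of_nonneg
        (Finset.image_subset_iff.2 hmaps) fun q hq _ => hv q hq

theorem sum_assignWeight_eq_le {a : R → ℕ} (ha : ∀ l, 1 ≤ a l) {x : ι → ℝ}
    (hx : x ∈ stdSimplex ℝ ι) (l : R) (i : ι) :
    ∑ f : R → ι with f l = i, assignWeight a x f ≤ x i := by
  have h := sum_assignWeight_le_prod ha hx {l} fun _ => i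
  simp only [Finset.mem_singleton, forall_eq, Finset.prod_singleton] at h
  refine h.trans ?_
  exact pow_le_of_le_one (hx.1 i)
    ((Finset.single_le_sum (fun i _ => hx.1 i) (Finset.mem_univ i)).trans hx.2.le)
    (by have := ha l; omega)

/-- All but one of the factors `x i` are traded for the larger `x j`, and surplus factors are
dropped since `x j ≤ 1`. One factor `x i` is kept so that the bound can be compared with the gain
from merging. -/
theorem sum_assignWeight_eq_eq_le {a : R → ℕ} (ha : ∀ l, 1 ≤ a l) {x : ι → ℝ}
    (hx : x ∈ stdSimplex ℝ ι) {b : ℕ} {l l' : R} (hl : l ≠ l') (hb : b + 1 ≤ a l + a l')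
    {i j : ι} (hij : x i ≤ x j) :
    ∑ f : R → ι with f l = i ∧ f l' = j, assignWeight a x f ≤ x i * x j ^ b := by
  have h := sum_assignWeight_le_prod ha hx {l, l'} fun m => if m = l then i else j
  rw [Finset.prod_pair hl] at h
  simp only [Finset.mem_insert, Finset.mem_singleton, forall_eq_or_imp, forall_eq, if_true,
    if_neg hl.symm] at h
  refine h.trans ?_
  have hj1 : x j ≤ 1 := (Finset.single_le_sum (fun i _ => hx.1 i) (Finset.mem_univ j)).trans hx.2.le
  have hl1 := ha l
  obtain ⟨n, hn⟩ : ∃ n, a l = n + 1 := ⟨a l - 1, by omega⟩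
  calc x i ^ a l * x j ^ a l' = x i * (x i ^ n * x j ^ a l') := by rw [hn]; ring
    _ ≤ x i * (x j ^ n * x j ^ a l') := by
        have := hx.1 i
        have := hx.1 j
        gcongr
    _ = x i * x j ^ (n + a l') := by rw [pow_add]
    _ ≤ x i * x j ^ b :=
        mul_le_mul_of_nonneg_left (pow_le_pow_of_le_one (hx.1 j) hj1 (by omega)) (hx.1 i)

/-- This is the loss in merging `i` and `j`: a union bound over the pair of parts of $F$ placed
there. -/
theorem sum_injective_both_le {a : R → ℕ} (ha : ∀ l, 1 ≤ a l) {x : ι → ℝ}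
    (hx : x ∈ stdSimplex ℝ ι) {b : ℕ} (hb : ∀ l l', l ≠ l' → b + 1 ≤ a l + a l')
    {i j : ι} (hne : i ≠ j) (hij : x i ≤ x j) :
    ∑ f : R → ι with Function.Injective f ∧ i ∈ Set.range f ∧ j ∈ Set.range f, assignWeight a x f
      ≤ (Fintype.card R : ℝ) ^ 2 * (x i * x j ^ b) := by
  have hW := fun f => assignWeight_nonneg (a := a) hx.1 f
  have hxij : 0 ≤ x i * x j ^ b := mul_nonneg (hx.1 i) (pow_nonneg (hx.1 j) _)
  calc _ ≤ ∑ f : R → ι with ∃ p : R × R, f p.1 = i ∧ f p.2 = j, assignWeight a x f := by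
        refine Finset.sum_le_sum_of_subset_of_nonneg ?_ fun f _ _ => hW f
        intro f hf
        simp only [Finset.mem_filter, Finset.mem_univ, true_and] at hf ⊢
        obtain ⟨-, ⟨l, hl⟩, l', hl'⟩ := hf
        exact ⟨(l, l'), hl, hl'⟩
    _ ≤ ∑ p : R × R, ∑ f : R → ι with f p.1 = i ∧ f p.2 = j, assignWeight a x f :=
        sum_filter_exists_le _ hW
    _ ≤ ∑ _p : R × R, x i * x j ^ b := by
        refine Finset.sum_le_sum fun p _ => ?_
        by_cases hp : p.1 = p.2
        · rw [Finset.sum_eq_zero]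
          · exact hxij
          · intro f hf
            simp only [Finset.mem_filter, Finset.mem_univ, true_and] at hf
            exact absurd (hf.1.symm.trans (hp ▸ hf.2)) hne
        · exact sum_assignWeight_eq_eq_le ha hx hp (hb _ _ hp) hij
    _ = _ := by simp [Fintype.card_prod, sq]

/-- The part of `assignWeight` that does not come from the part `l₀`. -/
noncomputable def restWeight (a : R → ℕ) (x : ι → ℝ) (l₀ : R) (f : R → ι) : ℝ :=
  ∏ l ∈ Finset.univ.erase l₀, x (f l) ^ a l

omit [Fintype ι] in
theorem assignWeight_eq_mul_rest (a : R → ℕ) (x : ι → ℝ) (l₀ : R) (f : R → ι) :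
    assignWeight a x f = x (f l₀) ^ a l₀ * restWeight a x l₀ f :=
  (Finset.mul_prod_erase _ _ (Finset.mem_univ l₀)).symm

omit [Fintype ι] in
theorem restWeight_nonneg {a : R → ℕ} {x : ι → ℝ} (hx : ∀ i, 0 ≤ x i) (l₀ : R) (f : R → ι) :
    0 ≤ restWeight a x l₀ f :=
  Finset.prod_nonneg fun _ _ => pow_nonneg (hx _) _

omit [Fintype ι] in
theorem restWeight_congr (a : R → ℕ) {x x' : ι → ℝ} {l₀ : R} {f f' : R → ι}
    (h : ∀ l ≠ l₀, x (f l) = x' (f' l)) : restWeight a x l₀ f = restWeight a x' l₀ f' :=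
  Finset.prod_congr rfl fun l hl => by rw [h l (Finset.ne_of_mem_erase hl)]

/-- If no part other than `l₀` sits at `i` or `j`, then `l₀` can be rerouted to `j`; its original
position sums out to a factor at most 1. All remaining placements put some part at `i` or `j`, which
costs at most `x i + x j` per part. -/
theorem injSum_le_sum_rest {a : R → ℕ} (ha : ∀ l, 1 ≤ a l) {x : ι → ℝ}
    (hx : x ∈ stdSimplex ℝ ι) (l₀ : R) {i j : ι} (hne : i ≠ j) :
    injSum a x ≤ ∑ f : R → ι with Function.Injective f ∧ f l₀ = j ∧ i ∉ Set.range f,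
      restWeight a x l₀ f + Fintype.card R * (x i + x j) := by
  have hW := fun f => assignWeight_nonneg (a := a) hx.1 f
  have hr := fun f => restWeight_nonneg (a := a) hx.1 l₀ f
  rw [injSum, ← Finset.sum_filter_add_sum_filter_not _
    fun f : R → ι => ∀ l ≠ l₀, f l ≠ i ∧ f l ≠ j]
  refine add_le_add ?_ ?_
  · set T : Finset (R → ι) :=
      Finset.univ.filter fun f => Function.Injective f ∧ f l₀ = j ∧ i ∉ Set.range f with hT
    calc _ = ∑ f ∈ (Finset.univ.filter fun f : R → ι => Function.Injective f).filter
            (fun f => ∀ l ≠ l₀, f l ≠ i ∧ f l ≠ j),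
            x (f l₀) ^ a l₀ * restWeight a x l₀ (Function.update f l₀ j) := by
          refine Finset.sum_congr rfl fun f _ => ?_
          rw [assignWeight_eq_mul_rest a x l₀]
          congr 1
          exact restWeight_congr a fun l hl => by rw [Function.update_of_ne hl]
      _ ≤ ∑ p ∈ T ×ˢ (Finset.univ : Finset ι), x p.2 ^ a l₀ * restWeight a x l₀ p.1 := by
          -- The rerouted placement together with the old value at `l₀` determines `f`.
          refine sum_le_sum_of_injOn (fun f => (Function.update f l₀ j, f l₀)) ?_ ?_
            (fun _ _ => le_rfl) fun p _ => mul_nonneg (pow_nonneg (hx.1 _) _) (hr _)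
          · intro f hf
            simp only [Finset.mem_filter, Finset.mem_univ, true_and] at hf
            obtain ⟨hinj, hf⟩ := hf
            simp only [hT, Finset.mem_product, Finset.mem_filter, Finset.mem_univ, true_and,
              and_true, Function.update_self]
            refine ⟨fun l l' h => ?_, ?_⟩
            · by_cases h1 : l = l₀ <;> by_cases h2 : l' = l₀
              · rw [h1, h2]
              · rw [h1, Function.update_self, Function.update_of_ne h2] at h
                exact absurd h.symm (hf l' h2).2
              · rw [h2, Function.update_self, Function.update_of_ne h1] at h
                exact absurd h (hf l h1).2
              · rw [Function.update_of_ne h1, Function.update_of_ne h2] at h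
                exact hinj h
            · rintro ⟨l, hl⟩
              by_cases h1 : l = l₀
              · rw [h1, Function.update_self] at hl
                exact hne hl.symm
              · rw [Function.update_of_ne h1] at hl
                exact (hf l h1).1 hl
          · intro f _ f' _ h
            simp only [Prod.mk.injEq] at h
            funext l
            by_cases h1 : l = l₀
            · rw [h1, h.2]
            · have := congrFun h.1 l
              rwa [Function.update_of_ne h1, Function.update_of_ne h1] at this
      _ = ∑ f ∈ T, restWeight a x l₀ f * ∑ q, x q ^ a l₀ := by
          rw [Finset.sum_product]
          refine Finset.sum_congr rfl fun f _ => ?_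
          rw [Finset.mul_sum]
          exact Finset.sum_congr rfl fun q _ => mul_comm _ _
      _ ≤ ∑ f ∈ T, restWeight a x l₀ f :=
          Finset.sum_le_sum fun f _ => mul_le_of_le_one_right (hr f) (sum_pow_le_one hx (ha _) _)
  · calc _ ≤ ∑ f : R → ι with ∃ l, f l = i ∨ f l = j, assignWeight a x f := by
          refine Finset.sum_le_sum_of_subset_of_nonneg ?_ fun f _ _ => hW f
          intro f hf
          simp only [Finset.mem_filter, Finset.mem_univ, true_and] at hf ⊢
          by_contra! hcon
          exact hf.2 fun l _ => hcon l
      _ ≤ ∑ l, ∑ f : R → ι with f l = i ∨ f l = j, assignWeight a x f :=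
          sum_filter_exists_le (fun l (f : R → ι) => f l = i ∨ f l = j) hW
      _ ≤ ∑ _l : R, (x i + x j) := by
          refine Finset.sum_le_sum fun l _ => ?_
          rw [Finset.filter_or, Finset.sum_union]
          · exact add_le_add (sum_assignWeight_eq_le ha hx l i) (sum_assignWeight_eq_le ha hx l j)
          · rw [Finset.disjoint_filter]
            rintro f - rfl
            exact hne
      _ = _ := by simp only [Finset.sum_const, Finset.card_univ, nsmul_eq_mul]

/-- Placements are classified by which of `i`, `j` they use. Those using neither keep their weight;
those using exactly one are paired by swapping `i` and `j`, and each pair gains; those using both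
are lost. The smallness of `x j` makes the gain from `l₀` alone cover the loss. -/
theorem injSum_le_merge {a : R → ℕ} (ha : ∀ l, 1 ≤ a l) {x : ι → ℝ} (hx : x ∈ stdSimplex ℝ ι)
    {l₀ : R} (hl₀ : 2 ≤ a l₀) (hb : ∀ l l', l ≠ l' → a l₀ + 1 ≤ a l + a l')
    {i j : ι} (hne : i ≠ j) (hij : x i ≤ x j)
    (hsmall : x j * ((Fintype.card R : ℝ) ^ 2 + 2 * Fintype.card R) ≤ injSum a x) :
    injSum a x ≤ injSum a (Function.update (Function.update x i 0) j (x i + x j)) := by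
  set x' := Function.update (Function.update x i 0) j (x i + x j) with hx'
  set y := x i with hy
  set z := x j with hz
  have hy0 : 0 ≤ y := hx.1 i
  have hz0 : 0 ≤ z := hx.1 j
  have hx'j : x' j = y + z := by simp [hx']
  have hx'o : ∀ q, q ≠ i → q ≠ j → x' q = x q := fun q h1 h2 => by
    rw [hx', Function.update_of_ne h2, Function.update_of_ne h1]
  have hx'0 : ∀ q, 0 ≤ x' q := fun q => by
    by_cases h2 : q = j
    · rw [h2, hx'j]; positivity
    · by_cases h1 : q = i
      · simp [hx', h1, hne]
      · rw [hx'o q h1 h2]; exact hx.1 q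
  set Φ : Finset (R → ι) := Finset.univ.filter fun f => Function.Injective f with hΦ
  set Φ₀ := Φ.filter fun f => i ∉ Set.range f ∧ j ∉ Set.range f with hΦ₀
  set Φj := Φ.filter fun f => i ∉ Set.range f ∧ j ∈ Set.range f with hΦj
  set Φi := Φ.filter fun f => i ∈ Set.range f ∧ j ∉ Set.range f with hΦi
  set Φ₂ := Φ.filter fun f => i ∈ Set.range f ∧ j ∈ Set.range f with hΦ₂
  have hsplit : ∀ v : (R → ι) → ℝ, ∑ f ∈ Φ, v f
      = ∑ f ∈ Φ₀, v f + ∑ f ∈ Φj, v f + ∑ f ∈ Φi, v f + ∑ f ∈ Φ₂, v f := fun v => by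
    rw [← Finset.sum_filter_add_sum_filter_not Φ fun f => i ∈ Set.range f,
      ← Finset.sum_filter_add_sum_filter_not (Φ.filter fun f => i ∈ Set.range f)
        fun f => j ∈ Set.range f,
      ← Finset.sum_filter_add_sum_filter_not (Φ.filter fun f => i ∉ Set.range f)
        fun f => j ∈ Set.range f]
    simp only [Finset.filter_filter, hΦ₀, hΦj, hΦi, hΦ₂]
    ring
  -- After the merge, the placement at `j` alone carries the weight of the pair formed by `f` and
  -- its swap, plus a surplus from expanding the power.
  have hgain : ∀ f : R → ι, Function.Injective f → i ∉ Set.range f → ∀ l, f l = j →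
      assignWeight a x' f - assignWeight a x f - assignWeight a x (Equiv.swap i j ∘ f)
        = ((y + z) ^ a l - z ^ a l - y ^ a l) * restWeight a x l f := by
    intro f hf hi l hl
    have h1 : ∀ m ≠ l, f m ≠ i ∧ f m ≠ j := fun m hm =>
      ⟨fun h => hi ⟨m, h⟩, fun h => hm (hf (h.trans hl.symm))⟩
    rw [assignWeight_eq_mul_rest a x' l, assignWeight_eq_mul_rest a x l,
      assignWeight_eq_mul_rest a x l (Equiv.swap i j ∘ f),
      restWeight_congr a (x := x') (x' := x) (f' := f) fun m hm => hx'o _ (h1 m hm).1 (h1 m hm).2,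
      restWeight_congr a (x := x) (x' := x) (f := Equiv.swap i j ∘ f) (f' := f) fun m hm => by
        rw [Function.comp_apply, Equiv.swap_apply_of_ne_of_ne (h1 m hm).1 (h1 m hm).2],
      Function.comp_apply, hl, Equiv.swap_apply_right, hx'j]
    ring
  have hrest := fun l f => restWeight_nonneg (a := a) hx.1 l f
  have hswap : ∑ f ∈ Φi, assignWeight a x f
      = ∑ f ∈ Φj, assignWeight a x (Equiv.swap i j ∘ f) := by
    refine Finset.sum_nbij' (fun f => Equiv.swap i j ∘ f) (fun f => Equiv.swap i j ∘ f) ?_ ?_ ?_ ?_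
      ?_
    · intro f hf
      simp only [hΦi, hΦj, hΦ, Finset.mem_filter, Finset.mem_univ, true_and, Set.mem_range,
        Function.comp_apply] at hf ⊢
      refine ⟨(Equiv.swap i j).injective.comp hf.1, ?_, ?_⟩
      · rintro ⟨l, hl⟩
        rw [Equiv.swap_apply_eq_iff, Equiv.swap_apply_left] at hl
        exact hf.2.2 ⟨l, hl⟩
      · obtain ⟨l, hl⟩ := hf.2.1
        exact ⟨l, by rw [hl, Equiv.swap_apply_left]⟩
    · intro f hf
      simp only [hΦi, hΦj, hΦ, Finset.mem_filter, Finset.mem_univ, true_and, Set.mem_range,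
        Function.comp_apply] at hf ⊢
      refine ⟨(Equiv.swap i j).injective.comp hf.1, ?_, ?_⟩
      · obtain ⟨l, hl⟩ := hf.2.2
        exact ⟨l, by rw [hl, Equiv.swap_apply_right]⟩
      · rintro ⟨l, hl⟩
        rw [Equiv.swap_apply_eq_iff, Equiv.swap_apply_right] at hl
        exact hf.2.1 ⟨l, hl⟩
    · intro f _
      funext l
      simp
    · intro f _
      funext l
      simp
    · intro f _
      congr 1
      funext l
      simp
  have hboth : ∑ f ∈ Φ₂, assignWeight a x f ≤ (Fintype.card R : ℝ) ^ 2 * (y * z ^ a l₀) := by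
    rw [hΦ₂, hΦ, Finset.filter_filter]
    exact sum_injective_both_le ha hx hb hne hij
  obtain ⟨n, hn⟩ : ∃ n, a l₀ = n + 2 := ⟨a l₀ - 2, by omega⟩
  -- Superadditivity of the power `n + 1` keeps the cross term `y * z ^ (n + 1)`; it needs `a l₀ ≥
  -- 2`, as exponent 1 gives no surplus.
  have hbin : y * z ^ (n + 1) ≤ (y + z) ^ a l₀ - z ^ a l₀ - y ^ a l₀ := by
    have h1 := pow_add_pow_le hy0 hz0 (n := n + 1) (by omega)
    have h2 : y * (y ^ (n + 1) + z ^ (n + 1)) ≤ y * (y + z) ^ (n + 1) :=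
      mul_le_mul_of_nonneg_left h1 hy0
    have h3 : z * (z ^ (n + 1)) ≤ z * (y + z) ^ (n + 1) :=
      mul_le_mul_of_nonneg_left (le_trans (le_add_of_nonneg_left (pow_nonneg hy0 _)) h1) hz0
    have h4 : (y + z) ^ (n + 2) = y * (y + z) ^ (n + 1) + z * (y + z) ^ (n + 1) := by ring
    have h5 : z ^ (n + 2) = z * z ^ (n + 1) := by ring
    have h6 : y ^ (n + 2) = y * y ^ (n + 1) := by ring
    rw [hn, h4, h5, h6]
    linarith
  have hgainsum : y * z ^ (n + 1) * (injSum a x - Fintype.card R * (y + z))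
      ≤ ∑ f ∈ Φj, (assignWeight a x' f - assignWeight a x f
          - assignWeight a x (Equiv.swap i j ∘ f)) := by
    set T : Finset (R → ι) := Finset.univ.filter fun f =>
      Function.Injective f ∧ f l₀ = j ∧ i ∉ Set.range f with hT
    calc _ ≤ y * z ^ (n + 1) * ∑ f ∈ T, restWeight a x l₀ f := by
          refine mul_le_mul_of_nonneg_left ?_ (by positivity)
          have := injSum_le_sum_rest ha hx l₀ hne
          linarith
      _ = ∑ f ∈ T, y * z ^ (n + 1) * restWeight a x l₀ f := Finset.mul_sum _ _ _
      _ ≤ ∑ f ∈ T, (assignWeight a x' f - assignWeight a x f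
          - assignWeight a x (Equiv.swap i j ∘ f)) := by
          refine Finset.sum_le_sum fun f hf => ?_
          simp only [hT, Finset.mem_filter, Finset.mem_univ, true_and] at hf
          rw [hgain f hf.1 hf.2.2 l₀ hf.2.1]
          exact mul_le_mul_of_nonneg_right hbin (hrest _ _)
      _ ≤ _ := by
          refine Finset.sum_le_sum_of_subset_of_nonneg ?_ ?_
          · intro f hf
            simp only [hT, hΦj, hΦ, Finset.mem_filter, Finset.mem_univ, true_and] at hf ⊢
            exact ⟨hf.1, hf.2.2, l₀, hf.2.1⟩
          -- Placements with another part at `j` also have a nonnegative surplus, so they may be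
          -- discarded.
          · intro f hf _
            simp only [hΦj, hΦ, Finset.mem_filter, Finset.mem_univ, true_and] at hf
            obtain ⟨hf, hi, l, hl⟩ := hf
            rw [hgain f hf hi l hl]
            refine mul_nonneg ?_ (hrest _ _)
            have := pow_add_pow_le hy0 hz0 (n := a l) (by have := ha l; omega)
            linarith
  -- By `y ≤ z`, the bracket is at least the sum minus `2 * |R| * z`, and `hsmall` leaves at least
  -- `|R| ^ 2 * z`.
  have hmain : (Fintype.card R : ℝ) ^ 2 * (y * z ^ a l₀)
      ≤ y * z ^ (n + 1) * (injSum a x - Fintype.card R * (y + z)) := by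
    have h1 : (Fintype.card R : ℝ) ^ 2 * (y * z ^ a l₀)
        = y * z ^ (n + 1) * (z * (Fintype.card R : ℝ) ^ 2) := by rw [hn]; ring
    rw [h1]
    refine mul_le_mul_of_nonneg_left ?_ (by positivity)
    have : (Fintype.card R : ℝ) * y ≤ Fintype.card R * z :=
      mul_le_mul_of_nonneg_left hij (by positivity)
    linarith
  have hΦ₀eq : ∑ f ∈ Φ₀, assignWeight a x' f = ∑ f ∈ Φ₀, assignWeight a x f := by
    refine Finset.sum_congr rfl fun f hf => ?_
    simp only [hΦ₀, Finset.mem_filter] at hf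
    refine Finset.prod_congr rfl fun l _ => ?_
    rw [hx'o _ (fun h => hf.2.1 ⟨l, h⟩) fun h => hf.2.2 ⟨l, h⟩]
  have hnn : ∀ s : Finset (R → ι), 0 ≤ ∑ f ∈ s, assignWeight a x' f := fun s =>
    Finset.sum_nonneg fun f _ => assignWeight_nonneg hx'0 f
  have hS := hsplit (assignWeight a x)
  have hS' := hsplit (assignWeight a x')
  rw [Finset.sum_sub_distrib, Finset.sum_sub_distrib] at hgainsum
  have e1 : injSum a x = ∑ f ∈ Φ, assignWeight a x f := rfl
  have e2 : injSum a x' = ∑ f ∈ Φ, assignWeight a x' f := rfl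
  rw [e2]
  have := hnn Φi
  have := hnn Φ₂
  linarith

end InjectiveSum
-- Existence of an optimal finite partition.
section Optimum

open scoped Classical

variable {R ι κ : Type*} [Fintype R] [Fintype ι] [Fintype κ]

theorem continuous_injSum (a : R → ℕ) : Continuous (injSum a : (ι → ℝ) → ℝ) := by
  unfold injSum assignWeight
  fun_prop

/-- Parts of weight zero can be added or removed. -/
theorem injSum_comp_injective {a : R → ℕ} (ha : ∀ l, 1 ≤ a l) {e : ι → κ}
    (he : Function.Injective e) {x : κ → ℝ} (hx : ∀ p, p ∉ Set.range e → x p = 0) :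
    injSum a (x ∘ e) = injSum a x := by
  unfold injSum
  refine Finset.sum_of_injOn (fun f => e ∘ f) ?_ ?_ ?_ ?_
  · intro f _ f' _ h
    exact funext fun l => he (congrFun h l)
  · intro f hf
    simp only [Finset.coe_filter, Finset.mem_univ, true_and, Set.mem_ofPred_eq] at hf ⊢
    exact he.comp hf
  · intro f hf hf'
    simp only [Finset.mem_filter, Finset.mem_univ, true_and] at hf
    by_contra h0
    have hr : ∀ l, ∃ q, e q = f l := fun l => by
      by_contra hl
      refine h0 (Finset.prod_eq_zero (Finset.mem_univ l) ?_)
      rw [hx _ hl, zero_pow (by have := ha l; omega)]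
    choose g hg using hr
    refine hf' ⟨g, ?_, funext hg⟩
    simp only [Finset.coe_filter, Finset.mem_univ, true_and, Set.mem_ofPred_eq]
    intro l l' h
    exact hf (by rw [← hg, ← hg, h])
  · intro f _
    rfl

theorem comp_mem_stdSimplex {e : ι → κ} (he : Function.Injective e) {x : κ → ℝ}
    (hx0 : ∀ p, p ∉ Set.range e → x p = 0) (hx : x ∈ stdSimplex ℝ κ) :
    x ∘ e ∈ stdSimplex ℝ ι := by
  refine ⟨fun i => hx.1 _, ?_⟩
  rw [← hx.2]
  refine Finset.sum_of_injOn e he.injOn (by simp) ?_ (fun _ _ => rfl)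
  intro p _ hp
  exact hx0 p (by simpa using hp)

theorem exists_extension {a : R → ℕ} (ha : ∀ l, 1 ≤ a l) (h : Fintype.card ι ≤ Fintype.card κ)
    {x : ι → ℝ} (hx : x ∈ stdSimplex ℝ ι) :
    ∃ y ∈ stdSimplex ℝ κ, injSum a y = injSum a x := by
  obtain ⟨e⟩ := Function.Embedding.nonempty_of_card_le h
  have h0 : ∀ p, p ∉ Set.range e → Function.extend e x 0 p = 0 := fun p hp => by
    rw [Function.extend_apply' _ _ _ hp]; rfl
  have h1 : Function.extend e x 0 ∘ e = x := Function.extend_comp e.injective _ _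
  refine ⟨Function.extend e x 0, ⟨fun p => ?_, ?_⟩, ?_⟩
  · by_cases hp : p ∈ Set.range e
    · obtain ⟨i, rfl⟩ := hp
      rw [e.injective.extend_apply]
      exact hx.1 i
    · rw [h0 p hp]
  · rw [← hx.2]
    symm
    refine Finset.sum_of_injOn e e.injective.injOn (by simp) ?_ ?_
    · intro p _ hp
      exact h0 p (by simpa using hp)
    · intro i _
      rw [e.injective.extend_apply]
  · rw [← injSum_comp_injective ha e.injective h0, h1]

theorem exists_restriction {a : R → ℕ} (ha : ∀ l, 1 ≤ a l) {x : ι → ℝ}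
    (hx : x ∈ stdSimplex ℝ ι) :
    ∃ y ∈ stdSimplex ℝ (Fin (Finset.univ.filter fun i => x i ≠ 0).card),
      (∀ i, 0 < y i) ∧ injSum a y = injSum a x := by
  set s := Finset.univ.filter fun i => x i ≠ 0 with hs
  set e : Fin s.card → ι := fun i => (s.equivFin.symm i : ι) with he
  have hinj : Function.Injective e := Subtype.val_injective.comp s.equivFin.symm.injective
  have h0 : ∀ p, p ∉ Set.range e → x p = 0 := fun p hp => by
    by_contra hne
    have hps : p ∈ s := by simp [hs, hne]
    exact hp ⟨s.equivFin ⟨p, hps⟩, by simp [he]⟩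
  refine ⟨x ∘ e, comp_mem_stdSimplex hinj h0 hx, fun i => ?_, injSum_comp_injective ha hinj h0⟩
  have : e i ∈ s := (s.equivFin.symm i).2
  exact lt_of_le_of_ne (hx.1 _) (Ne.symm (Finset.mem_filter.1 this).2)

theorem merge_mem_stdSimplex {x : ι → ℝ} (hx : x ∈ stdSimplex ℝ ι) {i j : ι} (hne : i ≠ j) :
    Function.update (Function.update x i 0) j (x i + x j) ∈ stdSimplex ℝ ι := by
  have h : ∀ q, Function.update (Function.update x i 0) j (x i + x j) q
      = x q + (if q = j then x i else 0) - (if q = i then x i else 0) := fun q => by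
    by_cases h1 : q = j
    · subst h1
      simp [hne.symm, add_comm]
    · by_cases h2 : q = i
      · subst h2
        simp [h1]
      · simp [h1, h2]
  constructor
  · intro q
    by_cases h1 : q = j
    · subst h1
      simpa using add_nonneg (hx.1 _) (hx.1 _)
    · by_cases h2 : q = i
      · subst h2
        simp [h1]
      · simpa [h1, h2] using hx.1 q
  · simp only [h, Finset.sum_sub_distrib, Finset.sum_add_distrib, hx.2]
    simp

theorem injSum_pos {a : R → ℕ} {x : ι → ℝ} (hx : ∀ i, 0 < x i) (e : R ↪ ι) : 0 < injSum a x := by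
  refine Finset.sum_pos (fun f _ => Finset.prod_pos fun l _ => pow_pos (hx _) _) ⟨e, ?_⟩
  simp [e.injective]

/-- Fewer than `N` weights can exceed `c`, since the weights sum to 1. -/
theorem exists_two_small {x : ι → ℝ} (hx : x ∈ stdSimplex ℝ ι) {c : ℝ} {N : ℕ} (hN : 1 < N * c)
    (hcard : N + 2 ≤ (Finset.univ.filter fun i => x i ≠ 0).card) :
    ∃ i j, i ≠ j ∧ x i ≠ 0 ∧ x j ≠ 0 ∧ x i ≤ x j ∧ x j ≤ c := by
  set s := Finset.univ.filter fun i => x i ≠ 0 with hs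
  have hc : 0 < c := by
    by_contra hc
    have : (N : ℝ) * c ≤ 0 := mul_nonpos_of_nonneg_of_nonpos (by positivity) (not_lt.1 hc)
    linarith
  have hbig : ((s.filter fun i => ¬ x i ≤ c).card : ℝ) * c ≤ 1 := by
    calc ((s.filter fun i => ¬ x i ≤ c).card : ℝ) * c = ∑ _i ∈ s.filter fun i => ¬ x i ≤ c, c := by
          rw [Finset.sum_const, nsmul_eq_mul]
      _ ≤ ∑ i ∈ s.filter fun i => ¬ x i ≤ c, x i := by
          refine Finset.sum_le_sum fun i hi => ?_
          exact (not_le.1 (Finset.mem_filter.1 hi).2).le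
      _ ≤ ∑ i, x i :=
          Finset.sum_le_sum_of_subset_of_nonneg (Finset.subset_univ _) fun i _ _ => hx.1 i
      _ = 1 := hx.2
  have hbig' : (s.filter fun i => ¬ x i ≤ c).card < N := by
    have : ((s.filter fun i => ¬ x i ≤ c).card : ℝ) * c < N * c := by linarith
    exact_mod_cast lt_of_mul_lt_mul_right this hc.le
  have hsum := Finset.card_filter_add_card_filter_not (s := s) fun i => x i ≤ c
  obtain ⟨i, hi, j, hj, hij⟩ :=
    Finset.one_lt_card.1 (show 1 < (s.filter fun i => x i ≤ c).card by omega)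
  simp only [hs, Finset.mem_filter, Finset.mem_univ, true_and] at hi hj
  rcases le_total (x i) (x j) with h | h
  · exact ⟨i, j, hij, hi.1, hj.1, h, hj.2⟩
  · exact ⟨j, i, hij.symm, hj.1, hi.1, h, hi.2⟩

/-- If at most one part of `K_a` is a singleton, then the optimal number of parts is finite. -/
theorem exists_optimal_partition {a : R → ℕ} (ha : ∀ l, 1 ≤ a l) {l₀ : R} (hl₀ : 2 ≤ a l₀)
    (hb : ∀ l l', l ≠ l' → a l₀ + 1 ≤ a l + a l') :
    ∃ t, ∃ x ∈ stdSimplex ℝ (Fin t), (∀ i, 0 < x i) ∧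
      ∀ s, ∀ y ∈ stdSimplex ℝ (Fin s), injSum a y ≤ injSum a x := by
  have : Nonempty R := ⟨l₀⟩
  have hr : (0 : ℝ) < Fintype.card R := by exact_mod_cast Fintype.card_pos
  -- Uniform weights give a positive benchmark. Only partitions beating it need to be merged, so the
  -- threshold for a small part can be chosen uniformly.
  set u : R → ℝ := fun _ => (Fintype.card R : ℝ)⁻¹ with hu
  have hu0 : ∀ l, 0 < u l := fun _ => inv_pos.2 hr
  have hus : u ∈ stdSimplex ℝ R := ⟨fun l => (hu0 l).le, by simp [hu]⟩
  have hS₀ : 0 < injSum a u := injSum_pos hu0 (Function.Embedding.refl R)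
  set K : ℝ := (Fintype.card R : ℝ) ^ 2 + 2 * Fintype.card R with hK
  have hK0 : 0 < K := by positivity
  obtain ⟨M, hM⟩ := exists_nat_gt (K / injSum a u)
  set N := max M (Fintype.card R) with hN
  have hNc : 1 < N * (injSum a u / K) := by
    have h1 : K / injSum a u < N := hM.trans_le (by exact_mod_cast le_max_left _ _)
    rw [div_lt_iff₀ hS₀] at h1
    rw [← mul_div_assoc, lt_div_iff₀ hK0]
    linarith
  obtain ⟨x, hx, hmax⟩ := (isCompact_stdSimplex (𝕜 := ℝ) (ι := Fin (N + 1))).exists_isMaxOn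
    ⟨_, single_mem_stdSimplex ℝ 0⟩ (continuous_injSum a).continuousOn
  have hmax' : ∀ {s : ℕ} (y : Fin s → ℝ), y ∈ stdSimplex ℝ (Fin s) → s ≤ N + 1 →
      injSum a y ≤ injSum a x := fun y hy hs => by
    obtain ⟨z, hz, hyz⟩ := exists_extension (κ := Fin (N + 1)) ha (by simpa using hs) hy
    rw [← hyz]
    exact hmax hz
  have huS : injSum a u ≤ injSum a x := by
    obtain ⟨z, hz, huz⟩ := exists_extension (κ := Fin (N + 1)) ha
      (by simpa using (le_max_right M (Fintype.card R)).trans (Nat.le_succ N)) hus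
    rw [← huz]
    exact hmax hz
  -- Induction on the number of nonzero weights: above `N + 1` of them, a merge removes one without
  -- lowering the sum.
  have key : ∀ n s, ∀ y ∈ stdSimplex ℝ (Fin s), (Finset.univ.filter fun i => y i ≠ 0).card ≤ n →
      injSum a y ≤ injSum a x := by
    intro n
    induction n with
    | zero =>
      intro s y hy hc
      obtain ⟨z, hz, -, hyz⟩ := exists_restriction ha hy
      rw [← hyz]
      exact hmax' z hz (by omega)
    | succ n ih =>
      intro s y hy hc
      by_cases hs : (Finset.univ.filter fun i => y i ≠ 0).card ≤ N + 1
      · obtain ⟨z, hz, -, hyz⟩ := exists_restriction ha hy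
        rw [← hyz]
        exact hmax' z hz hs
      by_cases hy0 : injSum a y ≤ injSum a u
      · exact hy0.trans huS
      obtain ⟨i, j, hij, hi, hj, hle, hjc⟩ := exists_two_small hy hNc (by omega)
      refine (injSum_le_merge ha hy hl₀ hb hij hle ?_).trans
        (ih s _ (merge_mem_stdSimplex hy hij) ?_)
      · rw [le_div_iff₀ hK0] at hjc
        linarith
      · have hlt : (Finset.univ.filter fun q =>
            Function.update (Function.update y i 0) j (y i + y j) q ≠ 0).card
            < (Finset.univ.filter fun q => y q ≠ 0).card := by
          refine Finset.card_lt_card ((Finset.ssubset_iff_of_subset ?_).2 ⟨i, by simp [hi], ?_⟩)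
          · intro q hq
            simp only [Finset.mem_filter, Finset.mem_univ, true_and] at hq ⊢
            by_cases h1 : q = j
            · rwa [h1]
            · by_cases h2 : q = i
              · rwa [h2]
              · rwa [Function.update_of_ne h1, Function.update_of_ne h2] at hq
          · simp [Function.update_of_ne hij]
        refine Nat.le_of_lt_succ (lt_of_le_of_lt (le_of_eq ?_) (hlt.trans_le hc))
        congr!
  obtain ⟨z, hz, hz0, hxz⟩ := exists_restriction ha hx
  refine ⟨_, z, hz, hz0, fun s y hy => ?_⟩
  rw [hxz]
  exact key _ s y hy le_rfl

end Optimum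

/-! ### The density in a weighted partition as a multiple of the injective sum. -/

section PartDensity

open scoped Classical

variable {V ι : Type*} [Fintype V] [Fintype ι]

/-- The probability that independent random parts, chosen with probabilities `x`, for the vertices
in `V` yield a copy of `F`. -/
noncomputable def partDensity (F : SimpleGraph V) (x : ι → ℝ) : ℝ :=
  ∑ g : V → ι with Nonempty ((⊤ : SimpleGraph ι).comap g ≃g F), ∏ v, x (g v)

/-- The permutations counted are the isomorphisms from `F` to `G`; composing with a fixed one
identifies them with the automorphisms of `F`. -/
theorem card_comap_eq (F G : SimpleGraph V) :
    ((Finset.univ.filter fun π : Equiv.Perm V => G.comap π = F).card : ℝ)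
      = if Nonempty (G ≃g F) then (Nat.card (F ≃g F) : ℝ) else 0 := by
  have h : (Finset.univ.filter fun π : Equiv.Perm V => G.comap π = F).card
      = Nat.card (F ≃g G) := by
    rw [← Fintype.card_subtype, ← Nat.card_eq_fintype_card]
    refine Nat.card_congr
      { toFun := fun π => ⟨π.1, fun {u v} => ?_⟩
        invFun := fun φ => ⟨φ.toEquiv, ?_⟩
        left_inv := fun _ => rfl
        right_inv := fun _ => rfl }
    · conv_rhs => rw [← π.2]
      rfl
    · ext u v
      exact φ.map_rel_iff
  rw [h]
  split_ifs with hne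
  · obtain ⟨φ⟩ := hne
    congr 1
    exact Nat.card_congr
      { toFun := fun ψ => ψ.trans φ
        invFun := fun ψ => ψ.trans φ.symm
        left_inv := fun ψ => by ext; simp
        right_inv := fun ψ => by ext; simp }
  · rw [Nat.cast_eq_zero]
    have : IsEmpty (F ≃g G) := ⟨fun φ => hne ⟨φ.symm⟩⟩
    exact Nat.card_of_isEmpty

/-- Double counting of pairs of a colouring and a relabelling replaces isomorphism with `F` by
equality with `F`: relabelling permutes the colourings and preserves their weight. -/
theorem card_aut_mul_partDensity (F : SimpleGraph V) (x : ι → ℝ) :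
    (Nat.card (F ≃g F) : ℝ) * partDensity F x
      = (Fintype.card V).factorial * ∑ g : V → ι with (⊤ : SimpleGraph ι).comap g = F,
          ∏ v, x (g v) := by
  calc (Nat.card (F ≃g F) : ℝ) * partDensity F x
      = ∑ g : V → ι, (∏ v, x (g v)) *
          (Finset.univ.filter fun π : Equiv.Perm V =>
            ((⊤ : SimpleGraph ι).comap g).comap π = F).card := by
        rw [partDensity, Finset.mul_sum, Finset.sum_filter]
        refine Finset.sum_congr rfl fun g _ => ?_
        rw [card_comap_eq]
        split_ifs
        · ring
        · ring
    _ = ∑ π : Equiv.Perm V, ∑ g : V → ι,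
          if (⊤ : SimpleGraph ι).comap (g ∘ π) = F then ∏ v, x ((g ∘ π) v) else 0 := by
        rw [Finset.sum_comm]
        refine Finset.sum_congr rfl fun g _ => ?_
        rw [Finset.card_filter, Nat.cast_sum, Finset.mul_sum]
        refine Finset.sum_congr rfl fun π _ => ?_
        have h : ∏ v, x ((g ∘ π) v) = ∏ v, x (g v) := Equiv.prod_comp π fun v => x (g v)
        rw [h, SimpleGraph.comap_comap]
        split_ifs <;> simp
    _ = ∑ _π : Equiv.Perm V, ∑ g : V → ι with (⊤ : SimpleGraph ι).comap g = F, ∏ v, x (g v) := by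
        refine Finset.sum_congr rfl fun π _ => ?_
        rw [Finset.sum_filter]
        exact Equiv.sum_comp (π.symm.arrowCongr (Equiv.refl ι))
          fun g : V → ι => if (⊤ : SimpleGraph ι).comap g = F then ∏ v, x (g v) else 0
    _ = _ := by rw [Finset.sum_const, Finset.card_univ, Fintype.card_perm, nsmul_eq_mul]

theorem sum_comap_eq_completePartite {r : ℕ} {a : Fin r → ℕ} (ha : ∀ l, 1 ≤ a l) (x : ι → ℝ) :
    ∑ g : (Σ l : Fin r, Fin (a l)) → ι with (⊤ : SimpleGraph ι).comap g = completePartite a,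
      ∏ v, x (g v) = injSum a x := by
  symm
  -- A colouring inducing exactly $K_a$ is constant on each part and separates distinct parts, so it
  -- is an injective map on parts, read off at vertex 0 of each (nonempty) part.
  refine Finset.sum_nbij' (fun f v => f v.1) (fun g l => g ⟨l, ⟨0, ha l⟩⟩) ?_ ?_ ?_ ?_ ?_
  · intro f hf
    simp only [Finset.mem_filter, Finset.mem_univ, true_and] at hf ⊢
    ext u v
    simp [hf.eq_iff]
  · intro g hg
    simp only [Finset.mem_filter, Finset.mem_univ, true_and] at hg ⊢
    intro l l' h
    by_contra hne
    have : (completePartite a).Adj ⟨l, ⟨0, ha l⟩⟩ ⟨l', ⟨0, ha l'⟩⟩ := by simpa using hne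
    rw [← hg] at this
    exact this h
  · intro f _
    rfl
  · intro g hg
    simp only [Finset.mem_filter, Finset.mem_univ, true_and] at hg
    funext v
    by_contra hne
    have : ((⊤ : SimpleGraph ι).comap g).Adj ⟨v.1, ⟨0, ha v.1⟩⟩ v := hne
    rw [hg] at this
    simp at this
  · intro f _
    rw [Fintype.prod_sigma]
    simp [assignWeight]

theorem card_aut_pos (F : SimpleGraph V) : 0 < Nat.card (F ≃g F) := by
  have : Finite (F ≃g F) :=
    Finite.of_injective (fun φ : F ≃g F => φ.toEquiv) fun φ ψ h => by ext v; exact congrArg (· v) h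
  exact Nat.card_pos_iff.2 ⟨⟨SimpleGraph.Iso.refl⟩, inferInstance⟩

theorem card_aut_mul_partDensity_completePartite {r : ℕ} {a : Fin r → ℕ} (ha : ∀ l, 1 ≤ a l)
    (x : ι → ℝ) :
    (Nat.card (completePartite a ≃g completePartite a) : ℝ) * partDensity (completePartite a) x
      = (Fintype.card (Σ l : Fin r, Fin (a l))).factorial * injSum a x := by
  rw [card_aut_mul_partDensity, ← sum_comap_eq_completePartite ha]
  congr!

theorem partDensity_le_of_injSum_le {r : ℕ} {a : Fin r → ℕ} (ha : ∀ l, 1 ≤ a l) {κ : Type*}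
    [Fintype κ] {x : ι → ℝ} {y : κ → ℝ} (h : injSum a y ≤ injSum a x) :
    partDensity (completePartite a) y ≤ partDensity (completePartite a) x := by
  have hN : (0 : ℝ) < Nat.card (completePartite a ≃g completePartite a) := by
    exact_mod_cast card_aut_pos _
  refine le_of_mul_le_mul_left ?_ hN
  rw [card_aut_mul_partDensity_completePartite ha, card_aut_mul_partDensity_completePartite ha]
  exact mul_le_mul_of_nonneg_left h (Nat.cast_nonneg _)

end PartDensity
-- Density and clique-freeness of complete partite graphons.
section PartiteGraphon

variable {t : ℕ}

theorem intervalIndex_lt (ht : 0 < t) (x : Fin t → ℝ) (y : I) : intervalIndex x y < t := by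
  unfold intervalIndex
  refine lt_of_lt_of_eq (Finset.card_lt_univ_of_notMem (x := ⟨t - 1, by omega⟩) ?_)
    (Fintype.card_fin t)
  simp only [Finset.mem_filter, not_and]
  intro _ h
  exact absurd h (by simp; omega)

/-- The partial sums are monotone, so the indices counted by `intervalIndex` form an initial
segment. -/
theorem intervalIndex_lt_iff {x : Fin t → ℝ} (hx : ∀ i, 0 ≤ x i) {m : ℕ} (hm : m + 1 < t) (y : I) :
    intervalIndex x y < m + 1 ↔ (y : ℝ) < ∑ i ∈ Finset.Iic (⟨m, by omega⟩ : Fin t), x i := by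
  set c : Fin t → ℝ := fun j => ∑ i ∈ Finset.Iic j, x i with hc
  have hmono : Monotone c := fun j k hjk =>
    Finset.sum_le_sum_of_subset_of_nonneg (Finset.Iic_subset_Iic.2 hjk) fun i _ _ => hx i
  constructor
  · intro h
    by_contra hle
    rw [not_lt] at hle
    refine absurd h (not_lt.2 ?_)
    have : (Finset.Iic (⟨m, by omega⟩ : Fin t)).card = m + 1 := by simp
    rw [← this]
    refine Finset.card_le_card fun j hj => ?_
    rw [Finset.mem_Iic] at hj
    simp only [Finset.mem_filter, Finset.mem_univ, true_and]
    refine ⟨?_, (hmono hj).trans hle⟩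
    have : (j : ℕ) ≤ m := hj
    omega
  · intro h
    rw [Nat.lt_succ_iff]
    have : (Finset.Iio (⟨m, by omega⟩ : Fin t)).card = m := by simp
    refine le_of_le_of_eq (Finset.card_le_card fun j hj => ?_) this
    simp only [Finset.mem_filter, Finset.mem_univ, true_and] at hj
    rw [Finset.mem_Iio]
    by_contra hle
    exact absurd (hj.2.trans_lt h) (not_lt.2 (hmono (not_lt.1 hle)))

theorem volume_intervalIndex_lt (ht : 0 < t) {x : Fin t → ℝ} (hx : x ∈ stdSimplex ℝ (Fin t))
    {n : ℕ} (hn : n ≤ t) :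
    volume {y : I | intervalIndex x y < n}
      = ENNReal.ofReal (∑ i ∈ Finset.univ.filter (fun i : Fin t => (i : ℕ) < n), x i) := by
  rcases n with _ | m
  · simp
  rcases hn.lt_or_eq with hm | hm
  · have hle : ∑ i ∈ Finset.Iic (⟨m, by omega⟩ : Fin t), x i ≤ 1 := by
      rw [← hx.2]
      exact Finset.sum_le_sum_of_subset_of_nonneg (Finset.subset_univ _) fun i _ _ => hx.1 i
    have hset : {y : I | intervalIndex x y < m + 1}
        = Set.Iio (⟨∑ i ∈ Finset.Iic (⟨m, by omega⟩ : Fin t), x i,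
            Finset.sum_nonneg fun i _ => hx.1 i, hle⟩ : I) := by
      ext y
      exact intervalIndex_lt_iff hx.1 hm y
    rw [hset, unitInterval.volume_Iio]
    congr 1
    refine Finset.sum_congr ?_ fun _ _ => rfl
    ext i
    simp only [Finset.mem_Iic, Finset.mem_filter, Finset.mem_univ, true_and, Fin.le_def]
    omega
  · have hset : {y : I | intervalIndex x y < m + 1} = Set.univ := by
      ext y
      simpa [hm] using intervalIndex_lt ht x y
    have hf : (Finset.univ.filter fun i : Fin t => (i : ℕ) < m + 1) = Finset.univ := by
      ext i
      simp [hm]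
    rw [hset, hf, hx.2]
    simp

theorem volume_intervalIndex_eq (ht : 0 < t) {x : Fin t → ℝ} (hx : x ∈ stdSimplex ℝ (Fin t))
    (i : Fin t) : volume {y : I | intervalIndex x y = i} = ENNReal.ofReal (x i) := by
  have hset : {y : I | intervalIndex x y = i}
      = {y : I | intervalIndex x y < (i : ℕ) + 1} \ {y : I | intervalIndex x y < i} := by
    ext y
    simp only [Set.mem_sdiff, Set.mem_ofPred_eq]
    omega
  have hsum : ∑ j ∈ Finset.univ.filter (fun j : Fin t => (j : ℕ) < (i : ℕ) + 1), x j
      = ∑ j ∈ Finset.univ.filter (fun j : Fin t => (j : ℕ) < (i : ℕ)), x j + x i := by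
    have : (Finset.univ.filter fun j : Fin t => (j : ℕ) < (i : ℕ) + 1)
        = insert i (Finset.univ.filter fun j : Fin t => (j : ℕ) < i) := by
      ext j
      simp only [Finset.mem_filter, Finset.mem_univ, true_and, Finset.mem_insert, Fin.ext_iff]
      omega
    rw [this, Finset.sum_insert (by simp), add_comm]
  have hsub : {y : I | intervalIndex x y < i} ⊆ {y : I | intervalIndex x y < (i : ℕ) + 1} :=
    fun y hy => Nat.lt_succ_of_lt hy
  rw [hset, measure_sdiff hsub
    ((measurable_intervalIndex x measurableSet_Iio).nullMeasurableSet) (measure_ne_top _ _),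
    volume_intervalIndex_lt ht hx i.2, volume_intervalIndex_lt ht hx i.2.le, hsum,
    ← ENNReal.ofReal_sub _ (Finset.sum_nonneg fun j _ => hx.1 j)]
  congr 1
  ring

/-- The interval indices of the random points are independent with law `x`, so the event is a
disjoint union of boxes, one for each index pattern inducing `F`. -/
theorem density_completePartiteGraphon (ht : 0 < t) {x : Fin t → ℝ}
    (hx : x ∈ stdSimplex ℝ (Fin t)) {V : Type*} [Fintype V] (F : SimpleGraph V) :
    (completePartiteGraphon x).density F = partDensity F x := by
  classical
  set idx : I → Fin t := fun y => ⟨intervalIndex x y, intervalIndex_lt ht x y⟩ with hidx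
  have hsample : ∀ p : V → I, (completePartiteGraphon x).sample p
      = (⊤ : SimpleGraph (Fin t)).comap (idx ∘ p) := fun p => by
    ext u v
    simp only [Graphon.sample, completePartiteGraphon, SimpleGraph.comap_adj, SimpleGraph.top_adj,
      hidx, Function.comp_apply, ne_eq, Fin.mk.injEq]
    constructor
    · rintro ⟨-, h⟩ h'
      simp [h'] at h
    · intro h
      refine ⟨fun huv => h (by rw [huv]), by simp [h]⟩
  have hmeas : Measurable idx := by
    refine measurable_to_countable' fun i => ?_
    have : idx ⁻¹' {i} = {y | intervalIndex x y = i} := by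
      ext y
      simp [hidx, Fin.ext_iff]
    rw [this]
    exact measurable_intervalIndex x (measurableSet_singleton _)
  have hvol : ∀ i, volume (idx ⁻¹' {i}) = ENNReal.ofReal (x i) := fun i => by
    rw [← volume_intervalIndex_eq ht hx i]
    congr 1
    ext y
    simp [hidx, Fin.ext_iff]
  set A := Finset.univ.filter fun g : V → Fin t =>
    Nonempty ((⊤ : SimpleGraph (Fin t)).comap g ≃g F) with hA
  have hset : {p : V → I | Nonempty ((completePartiteGraphon x).sample p ≃g F)}
      = ⋃ g ∈ A, Set.univ.pi fun v => idx ⁻¹' {g v} := by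
    ext p
    simp only [Set.mem_ofPred_eq, hsample, Set.mem_iUnion, Set.mem_pi, Set.mem_univ, true_imp_iff,
      Set.mem_preimage, Set.mem_singleton_iff, exists_prop, hA, Finset.mem_filter, Finset.mem_univ,
      true_and]
    constructor
    · intro h
      exact ⟨idx ∘ p, h, fun _ => rfl⟩
    · rintro ⟨g, hg, hpg⟩
      have : idx ∘ p = g := funext hpg
      rwa [this]
  rw [Graphon.density, hset, measure_biUnion_finset]
  · have : ∀ g ∈ A, volume (Set.univ.pi fun v => idx ⁻¹' {g v})
        = ENNReal.ofReal (∏ v, x (g v)) := fun g _ => by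
      rw [volume_pi_pi, ENNReal.ofReal_prod_of_nonneg fun v _ => hx.1 _]
      exact Finset.prod_congr rfl fun v _ => hvol _
    rw [Finset.sum_congr rfl this, ← ENNReal.ofReal_sum_of_nonneg, ENNReal.toReal_ofReal]
    · rw [partDensity, hA]
    · exact Finset.sum_nonneg fun g _ => Finset.prod_nonneg fun v _ => hx.1 _
    · exact fun g _ => Finset.prod_nonneg fun v _ => hx.1 _
  · intro g _ g' _ hne
    rw [Function.onFun, Set.disjoint_left]
    intro p hp hp'
    refine hne (funext fun v => ?_)
    have h1 : idx (p v) = g v := hp v trivial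
    have h2 : idx (p v) = g' v := hp' v trivial
    exact h1.symm.trans h2
  · intro g _
    exact MeasurableSet.univ_pi fun v => hmeas (measurableSet_singleton _)

theorem completePartiteGraphon_isFree (ht : 0 < t) (x : Fin t → ℝ) {k : ℕ} (hk : t < k) :
    (completePartiteGraphon x).IsFree (SimpleGraph.completeGraph (Fin k)) := by
  rintro ⟨p, hp⟩
  obtain ⟨u, v, huv, h⟩ := Fintype.exists_ne_map_eq_of_card_lt
    (fun u => (⟨intervalIndex x (p u), intervalIndex_lt ht x (p u)⟩ : Fin t)) (by simpa using hk)
  have := hp u v (by simpa using huv)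
  simp only [Fin.mk.injEq] at h
  simp [completePartiteGraphon, h] at this

end PartiteGraphon
-- Counting induced copies by embeddings, maps and random colourings.
section Counting

open scoped Classical

variable {V U ι : Type*} [Fintype V] [Fintype U] [Fintype ι]

/-- The filter in `inducedCount` runs over a `Finset (Set U)`, the image of `powersetCard` under
coercion. Injectivity of the coercion allows a return to finsets. -/
theorem inducedCount_eq_card (F : SimpleGraph V) (G : SimpleGraph U) :
    inducedCount F G = ((Finset.univ.powersetCard (Fintype.card V)).filter
      fun S : Finset U => Nonempty (G.induce (S : Set U) ≃g F)).card := by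
  rw [inducedCount]
  symm
  refine Finset.card_nbij (fun S : Finset U => (S : Set U)) ?_ Finset.coe_injective.injOn ?_
  · intro S hS
    have hS' := Finset.mem_filter.1 hS
    refine Finset.mem_filter.2 ⟨?_, hS'.2⟩
    simp only [Finset.bind_def, Finset.mem_sup, Finset.pure_def, Finset.mem_singleton]
    exact ⟨S, hS'.1, rfl⟩
  · intro T hT
    have hT' := Finset.mem_filter.1 hT
    obtain ⟨h1, h2⟩ := hT'
    simp only [Finset.bind_def, Finset.mem_sup, Finset.pure_def, Finset.mem_singleton] at h1
    obtain ⟨S, hS, rfl⟩ := h1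
    exact ⟨S, Finset.mem_filter.2 ⟨hS, h2⟩, rfl⟩

/-- Each vertex set inducing `F` is the image of exactly `|V|!` embeddings. -/
theorem inducedCount_mul_factorial (F : SimpleGraph V) (G : SimpleGraph U) :
    inducedCount F G * (Fintype.card V).factorial
      = (Finset.univ.filter fun f : V ↪ U => Nonempty (G.comap f ≃g F)).card := by
  have hiso : ∀ f : V ↪ U, Nonempty (G.comap f ≃g F) ↔
      Nonempty (G.induce ((Finset.univ.map f : Finset U) : Set U) ≃g F) := fun f => by
    have hc : ((Finset.univ.map f : Finset U) : Set U) = Set.range f := by simp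
    rw [hc]
    let e : G.comap f ≃g G.induce (Set.range f) :=
      ⟨Equiv.ofInjective f f.injective, Iff.rfl⟩
    exact ⟨fun ⟨φ⟩ => ⟨e.symm.trans φ⟩, fun ⟨φ⟩ => ⟨e.trans φ⟩⟩
  rw [Finset.card_eq_sum_card_fiberwise (f := fun f : V ↪ U => Finset.univ.map f)
    (t := (Finset.univ.powersetCard (Fintype.card V)).filter
      fun S : Finset U => Nonempty (G.induce (S : Set U) ≃g F))]
  · rw [inducedCount_eq_card, Finset.card_eq_sum_ones, Finset.sum_mul]
    refine Finset.sum_congr rfl fun S hS => ?_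
    simp only [Finset.mem_filter, Finset.mem_powersetCard] at hS
    obtain ⟨⟨-, hcard⟩, hS⟩ := hS
    have hEq : (Finset.univ.filter fun f : V ↪ U => Nonempty (G.comap f ≃g F)).filter
        (fun f => Finset.univ.map f = S) = Finset.univ.filter fun f : V ↪ U =>
          Finset.univ.map f = S := by
      ext f
      simp only [Finset.mem_filter, Finset.mem_univ, true_and, and_iff_right_iff_imp, hiso]
      rintro rfl
      exact hS
    rw [one_mul, hEq, ← Fintype.card_subtype]
    have e0 : V ≃ S := Fintype.equivOfCardEq (by rw [Fintype.card_coe, hcard])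
    rw [← Fintype.card_equiv e0]
    refine Fintype.card_congr
      { toFun := fun e => ⟨e.toEmbedding.trans (Function.Embedding.subtype _), ?_⟩
        invFun := fun f => Equiv.ofBijective
          (fun v => ⟨f.1 v, f.2.subset (Finset.mem_map_of_mem f.1 (Finset.mem_univ v))⟩) ⟨?_, ?_⟩
        left_inv := fun e => by ext; rfl
        right_inv := fun f => by ext; rfl }
    · ext u
      simp only [Finset.mem_map, Finset.mem_univ, true_and]
      constructor
      · rintro ⟨v, rfl⟩
        exact (e v).2
      · intro hu
        exact ⟨e.symm ⟨u, hu⟩, by simp⟩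
    · intro v w h
      exact f.1.injective (congrArg Subtype.val h)
    · rintro ⟨u, hu⟩
      obtain ⟨v, -, hv⟩ := Finset.mem_map.1 (f.2.symm.subset hu)
      exact ⟨v, Subtype.ext hv⟩
  · intro f hf
    simp only [Finset.coe_filter, Finset.mem_univ, true_and, Set.mem_ofPred_eq,
      Finset.mem_powersetCard, Finset.subset_univ, Finset.card_map,
      Finset.card_univ] at hf ⊢
    exact (hiso f).1 hf

theorem inducedDensity_eq (F : SimpleGraph V) (G : SimpleGraph U) :
    inducedDensity F G = ((Finset.univ.filter fun f : V ↪ U => Nonempty (G.comap f ≃g F)).card : ℝ)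
      / ((Fintype.card U).descFactorial (Fintype.card V) : ℝ) := by
  rw [← inducedCount_mul_factorial, Nat.descFactorial_eq_factorial_mul_choose, inducedDensity]
  push_cast
  have : ((Fintype.card V).factorial : ℝ) ≠ 0 := by positivity
  rw [mul_comm ((Fintype.card V).factorial : ℝ), mul_div_mul_right _ _ this]

/-- The colours of the vertices in the range of `f`, for independent random colours of all
vertices, are again independent random colours. -/
theorem sum_prod_comp_embedding {x : ι → ℝ} (hx : ∑ i, x i = 1) (f : V ↪ U) (P : (V → ι) → Prop) :
    ∑ c : U → ι with P (c ∘ f), ∏ u, x (c u) = ∑ g : V → ι with P g, ∏ v, x (g v) := by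
  rw [← Finset.sum_fiberwise_of_maps_to (s := Finset.univ.filter fun c : U → ι => P (c ∘ f))
    (t := Finset.univ.filter P) (g := fun c => c ∘ f) (by intro c; simp)]
  refine Finset.sum_congr rfl fun g hg => ?_
  rw [Finset.mem_filter] at hg
  set A : U → Finset ι := fun u => Finset.univ.filter fun q => ∀ v, f v = u → q = g v with hA
  have hset : (Finset.univ.filter fun c : U → ι => P (c ∘ f)).filter (fun c => c ∘ f = g)
      = Fintype.piFinset A := by
    ext c
    simp only [Finset.mem_filter, Finset.mem_univ, true_and, Fintype.mem_piFinset, hA]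
    constructor
    · rintro ⟨-, rfl⟩ u v rfl
      rfl
    · intro h
      have : c ∘ f = g := funext fun v => h _ v rfl
      exact ⟨this ▸ hg.2, this⟩
  rw [hset, ← Finset.prod_univ_sum A fun _ q => x q]
  symm
  refine Finset.prod_of_injOn f f.injective.injOn (by simp) ?_ ?_
  · intro u _ hu
    have : A u = Finset.univ := by
      ext q
      simp only [hA, Finset.mem_filter, Finset.mem_univ, true_and, iff_true]
      intro v hv
      exact absurd ⟨v, by simp, hv⟩ hu
    rw [this, hx]
  · intro v _
    have : A (f v) = {g v} := by
      ext q
      simp only [hA, Finset.mem_filter, Finset.mem_univ, true_and, Finset.mem_singleton]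
      exact ⟨fun h => h v rfl, fun h w hw => by rw [h, f.injective hw]⟩
    rw [this, Finset.sum_singleton]

theorem sum_prod_eq_one {x : ι → ℝ} (hx : ∑ i, x i = 1) : ∑ c : U → ι, ∏ u, x (c u) = 1 := by
  have := Finset.prod_univ_sum (fun _ : U => (Finset.univ : Finset ι)) fun _ q => x q
  rw [Fintype.piFinset_univ] at this
  rw [← this]
  simp [hx]

/-- A random complete partite graph has at least the expected induced density. -/
theorem exists_coloring_partDensity_le {x : ι → ℝ} (hx : x ∈ stdSimplex ℝ ι) (F : SimpleGraph V)
    (h : Fintype.card V ≤ Fintype.card U) :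
    ∃ c : U → ι, partDensity F x ≤ inducedDensity F ((⊤ : SimpleGraph ι).comap c) := by
  by_contra! hcon
  have hdf : (0 : ℝ) < (Fintype.card U).descFactorial (Fintype.card V) := by
    exact_mod_cast Nat.descFactorial_pos.2 h
  have hexp : ∑ c : U → ι, (∏ u, x (c u)) * inducedDensity F ((⊤ : SimpleGraph ι).comap c)
      = partDensity F x := by
    calc ∑ c : U → ι, (∏ u, x (c u)) * inducedDensity F ((⊤ : SimpleGraph ι).comap c)
        = (∑ c : U → ι, ∑ f : V ↪ U,
            if Nonempty ((⊤ : SimpleGraph ι).comap (c ∘ f) ≃g F) then ∏ u, x (c u) else 0)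
            / ((Fintype.card U).descFactorial (Fintype.card V) : ℝ) := by
          rw [Finset.sum_div]
          refine Finset.sum_congr rfl fun c _ => ?_
          rw [inducedDensity_eq, ← mul_div_assoc, Finset.card_filter, Nat.cast_sum, Finset.mul_sum]
          congr 1
          refine Finset.sum_congr rfl fun f _ => ?_
          rw [SimpleGraph.comap_comap]
          split_ifs <;> simp
      _ = (∑ _f : V ↪ U, partDensity F x)
            / ((Fintype.card U).descFactorial (Fintype.card V) : ℝ) := by
          rw [Finset.sum_comm]
          congr 1
          refine Finset.sum_congr rfl fun f _ => ?_
          rw [← Finset.sum_filter]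
          exact sum_prod_comp_embedding hx.2 f
            fun g => Nonempty ((⊤ : SimpleGraph ι).comap g ≃g F)
      _ = partDensity F x := by
          rw [Finset.sum_const, Finset.card_univ, Fintype.card_embedding_eq, nsmul_eq_mul]
          field_simp
  have hlt : ∑ c : U → ι, (∏ u, x (c u)) * inducedDensity F ((⊤ : SimpleGraph ι).comap c)
      < ∑ c : U → ι, (∏ u, x (c u)) * partDensity F x := by
    have hnn : ∀ c : U → ι, 0 ≤ ∏ u, x (c u) := fun c => Finset.prod_nonneg fun u _ => hx.1 _
    -- Strictness: the colouring weights sum to 1, so some colouring has positive weight.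
    refine Finset.sum_lt_sum (fun c _ => mul_le_mul_of_nonneg_left (hcon c).le (hnn c)) ?_
    by_contra! hle
    have h0 : ∀ c : U → ι, ∏ u, x (c u) = 0 := fun c => by
      by_contra hc
      have hpos : 0 < ∏ u, x (c u) := lt_of_le_of_ne (hnn c) (Ne.symm hc)
      exact absurd (mul_lt_mul_of_pos_left (hcon c) hpos) (not_lt.2 (hle c (Finset.mem_univ c)))
    have := sum_prod_eq_one (U := U) hx.2
    rw [Finset.sum_eq_zero fun c _ => h0 c] at this
    exact zero_ne_one this
  rw [hexp, ← Finset.sum_mul, sum_prod_eq_one hx.2, one_mul] at hlt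
  exact lt_irrefl _ hlt

/-- The number of maps `V(F) → V(G)`, injective or not, that induce a copy of `F`. -/
noncomputable def mapCount (F : SimpleGraph V) (G : SimpleGraph U) : ℕ :=
  (Finset.univ.filter fun f : V → U => Nonempty (G.comap f ≃g F)).card

/-- Allowing non-injective maps makes the count in a coloured graph an exact function of its class
proportions; the resulting factor `n ^ m / n.descFactorial m` tends to 1. -/
theorem inducedDensity_le_mapCount (F : SimpleGraph V) (G : SimpleGraph U) :
    inducedDensity F G
      ≤ (mapCount F G : ℝ) / ((Fintype.card U).descFactorial (Fintype.card V) : ℝ) := by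
  rw [inducedDensity_eq]
  refine div_le_div_of_nonneg_right ?_ (Nat.cast_nonneg _)
  rw [Nat.cast_le]
  refine Finset.card_le_card_of_injOn (fun f => (f : V → U)) ?_ ?_
  · intro f hf
    simpa using hf
  · intro f _ f' _ h
    exact DFunLike.coe_injective h

/-- The witness `x` is the vector of colour-class proportions of `c`; the maps with a given colour
pattern form a product set. -/
theorem mapCount_comap_top [Nonempty U] (F : SimpleGraph V) (c : U → ι) :
    ∃ x ∈ stdSimplex ℝ ι, (mapCount F ((⊤ : SimpleGraph ι).comap c) : ℝ)
      = (Fintype.card U : ℝ) ^ Fintype.card V * partDensity F x := by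
  have hU : (Fintype.card U : ℝ) ≠ 0 := by
    exact_mod_cast Fintype.card_ne_zero
  set N : ι → ℝ := fun q => ((Finset.univ.filter fun u => c u = q).card : ℝ) with hN
  refine ⟨fun q => N q / Fintype.card U, ⟨fun q => by positivity, ?_⟩, ?_⟩
  · rw [← Finset.sum_div, div_eq_one_iff_eq hU, hN, ← Nat.cast_sum, Nat.cast_inj]
    exact (Finset.card_eq_sum_card_fiberwise (s := (Finset.univ : Finset U))
      (f := c) (t := Finset.univ) (by simp)).symm
  · rw [partDensity, Finset.mul_sum, mapCount,
      Finset.card_eq_sum_card_fiberwise (f := fun f : V → U => c ∘ f)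
        (t := Finset.univ.filter fun g : V → ι => Nonempty ((⊤ : SimpleGraph ι).comap g ≃g F)),
      Nat.cast_sum]
    · refine Finset.sum_congr rfl fun g hg => ?_
      rw [Finset.mem_filter] at hg
      have hset : (Finset.univ.filter fun f : V → U =>
          Nonempty (((⊤ : SimpleGraph ι).comap c).comap f ≃g F)).filter (fun f => c ∘ f = g)
          = Fintype.piFinset fun v => Finset.univ.filter fun u => c u = g v := by
        ext f
        simp only [Finset.mem_filter, Finset.mem_univ, true_and, Fintype.mem_piFinset]
        constructor
        · rintro ⟨-, rfl⟩ v
          rfl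
        · intro h
          have : c ∘ f = g := funext h
          refine ⟨?_, this⟩
          rw [SimpleGraph.comap_comap, this]
          exact hg.2
      rw [hset, Fintype.card_piFinset, Nat.cast_prod, Finset.prod_div_distrib, Finset.prod_const,
        Finset.card_univ, mul_div_cancel₀ _ (pow_ne_zero _ hU)]
    · intro f hf
      exact Finset.mem_filter.2 ⟨Finset.mem_univ _, (Finset.mem_filter.1 hf).2⟩

end Counting
-- Zykov symmetrization.
section Symmetrization

open scoped Classical

variable {V U : Type*}

/-- The retraction that turns the vertex `u` into a clone of `v`. -/
noncomputable def cloneMap (u v : U) : U → U := Function.update id u v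

theorem cloneMap_self (u v : U) : cloneMap u v u = v := Function.update_self _ _ _

theorem cloneMap_of_ne {u w : U} (v : U) (h : w ≠ u) : cloneMap u v w = w :=
  Function.update_of_ne h _ _

/-- Non-adjacency is transitive in a complete multipartite graph, so non-adjacent `u` and `v` that
both lie in a copy of `F` are twins inside it. -/
theorem comap_cloneMap_comp {F : SimpleGraph V} (hF : F.IsCompleteMultipartite)
    {G : SimpleGraph U} {u v : U} (huv : ¬ G.Adj u v) {f : V → U}
    (hf : Nonempty (G.comap f ≃g F)) (hu : u ∈ Set.range f) (hv : v ∈ Set.range f) :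
    G.comap (cloneMap u v ∘ f) = G.comap f := by
  obtain ⟨φ⟩ := hf
  obtain ⟨x₀, hx₀⟩ := hu
  obtain ⟨y₀, hy₀⟩ := hv
  have htrans : ∀ x y z, ¬ G.Adj (f x) (f y) → ¬ G.Adj (f y) (f z) → ¬ G.Adj (f x) (f z) := by
    intro x y z h1 h2 h3
    have hiff : ∀ x y, F.Adj (φ x) (φ y) ↔ G.Adj (f x) (f y) := fun x y => φ.map_rel_iff
    rw [← hiff] at h1 h2 h3
    exact hF.trans _ _ _ h1 h2 h3
  have htwin : ∀ y, G.Adj u (f y) ↔ G.Adj v (f y) := fun y => by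
    have h1 := htrans x₀ y₀ y
    have h2 := htrans y₀ x₀ y
    rw [hx₀, hy₀] at h1 h2
    have h3 : ¬ G.Adj v u := fun h => huv h.symm
    tauto
  have hclone : ∀ w y, G.Adj (cloneMap u v w) (f y) ↔ G.Adj w (f y) := fun w y => by
    by_cases hw : w = u
    · rw [hw, cloneMap_self, htwin]
    · rw [cloneMap_of_ne v hw]
  have hrange : ∀ y, ∃ y', cloneMap u v (f y) = f y' := fun y => by
    by_cases hy : f y = u
    · exact ⟨y₀, by rw [hy, cloneMap_self, hy₀]⟩
    · exact ⟨y, cloneMap_of_ne v hy⟩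
  ext x y
  simp only [SimpleGraph.comap_adj, Function.comp_apply]
  obtain ⟨y', hy'⟩ := hrange y
  rw [hy', hclone, ← hy', G.adj_comm, hclone, G.adj_comm]

theorem cloneMap_comp_swap (u v : U) : cloneMap u v ∘ Equiv.swap u v = cloneMap u v := by
  funext w
  rw [Function.comp_apply]
  by_cases h1 : w = u
  · rw [h1, Equiv.swap_apply_left, cloneMap_self]
    by_cases h : v = u
    · rw [h, cloneMap_self]
    · rw [cloneMap_of_ne v h]
  · by_cases h2 : w = v
    · rw [h2, Equiv.swap_apply_right, cloneMap_self]
      by_cases h : v = u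
      · rw [h, cloneMap_self]
      · rw [cloneMap_of_ne v h]
    · rw [Equiv.swap_apply_of_ne_of_ne h1 h2]

theorem cloneMap_comp_of_notMem {u : U} (v : U) {f : V → U} (hu : u ∉ Set.range f) :
    cloneMap u v ∘ f = f :=
  funext fun x => cloneMap_of_ne v fun h => hu ⟨x, h⟩

theorem cloneMap_comp_eq_swap_comp {u v : U} {f : V → U} (hv : v ∉ Set.range f) :
    cloneMap u v ∘ f = Equiv.swap u v ∘ f := by
  funext x
  simp only [Function.comp_apply]
  have hx : f x ≠ v := fun h => hv ⟨x, h⟩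
  by_cases h : f x = u
  · rw [h, cloneMap_self, Equiv.swap_apply_left]
  · rw [cloneMap_of_ne v h, Equiv.swap_apply_of_ne_of_ne h hx]

/-- If `f` misses `u` or `v`, one cloning fixes `f` and the other acts as the swap, giving equality.
If `f` hits both and either `f` or its swap is a copy, then both clonings are copies. -/
theorem indicator_swap_le_indicator_clone {F : SimpleGraph V} (hF : F.IsCompleteMultipartite)
    {G : SimpleGraph U} {u v : U} (huv : ¬ G.Adj u v) (f : V → U) :
    (if Nonempty (G.comap f ≃g F) then 1 else 0)
        + (if Nonempty (G.comap (Equiv.swap u v ∘ f) ≃g F) then 1 else 0)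
      ≤ (if Nonempty (G.comap (cloneMap u v ∘ f) ≃g F) then 1 else 0)
        + (if Nonempty (G.comap (cloneMap v u ∘ f) ≃g F) then 1 else 0) := by
  have hvu : ¬ G.Adj v u := fun h => huv h.symm
  by_cases hv : v ∈ Set.range f
  · by_cases hu : u ∈ Set.range f
    · have key : ∀ f : V → U, u ∈ Set.range f → v ∈ Set.range f → Nonempty (G.comap f ≃g F) →
          Nonempty (G.comap (cloneMap u v ∘ f) ≃g F) ∧
            Nonempty (G.comap (cloneMap v u ∘ f) ≃g F) := fun f hu hv h => by
        rw [comap_cloneMap_comp hF huv h hu hv, comap_cloneMap_comp hF hvu h hv hu]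
        exact ⟨h, h⟩
      by_cases h1 : Nonempty (G.comap f ≃g F)
      · obtain ⟨h2, h3⟩ := key f hu hv h1
        rw [if_pos h1, if_pos h2, if_pos h3]
        split_ifs <;> simp
      · by_cases h4 : Nonempty (G.comap (Equiv.swap u v ∘ f) ≃g F)
        · obtain ⟨x, hx⟩ := hu
          obtain ⟨y, hy⟩ := hv
          obtain ⟨h2, h3⟩ := key (Equiv.swap u v ∘ f) ⟨y, by simp [hy]⟩ ⟨x, by simp [hx]⟩ h4
          rw [← Function.comp_assoc, cloneMap_comp_swap] at h2
          rw [← Function.comp_assoc, Equiv.swap_comm, cloneMap_comp_swap] at h3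
          rw [if_pos h2, if_pos h3]
          rw [if_neg h1, if_pos h4]
          simp
        · rw [if_neg h1, if_neg h4]
          simp
    · rw [cloneMap_comp_of_notMem v hu, cloneMap_comp_eq_swap_comp hu, Equiv.swap_comm]
  · rw [cloneMap_comp_of_notMem u hv, cloneMap_comp_eq_swap_comp hv, add_comm]

variable [Fintype V] [Fintype U]

theorem two_mul_mapCount_le {F : SimpleGraph V} (hF : F.IsCompleteMultipartite)
    {G : SimpleGraph U} {u v : U} (huv : ¬ G.Adj u v) :
    2 * mapCount F G
      ≤ mapCount F (G.comap (cloneMap u v)) + mapCount F (G.comap (cloneMap v u)) := by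
  have hswap : mapCount F G
      = ∑ f : V → U, if Nonempty (G.comap (Equiv.swap u v ∘ f) ≃g F) then 1 else 0 := by
    rw [mapCount, Finset.card_filter]
    exact (Equiv.sum_comp ((Equiv.refl V).arrowCongr (Equiv.swap u v))
      fun f : V → U => if Nonempty (G.comap f ≃g F) then 1 else 0).symm
  have h := Finset.sum_le_sum fun f (_ : f ∈ (Finset.univ : Finset (V → U))) =>
    indicator_swap_le_indicator_clone hF huv f
  rw [Finset.sum_add_distrib, Finset.sum_add_distrib, ← hswap] at h
  have hsum : ∀ H : SimpleGraph U,
      mapCount F H = ∑ f : V → U, if Nonempty (H.comap f ≃g F) then 1 else 0 := fun H => by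
    rw [mapCount, Finset.card_filter]
  rw [two_mul, hsum (G.comap _), hsum (G.comap _)]
  refine le_of_eq_of_le ?_ h
  rw [← hsum]

/-- The set of vertices with the same neighbours as `w`. -/
noncomputable def twinClass (G : SimpleGraph U) (w : U) : Finset U :=
  Finset.univ.filter fun w' => ∀ z, G.Adj w z ↔ G.Adj w' z

/-- The number of ordered pairs of vertices with the same neighbours. -/
noncomputable def twinCount (G : SimpleGraph U) : ℕ := ∑ w, (twinClass G w).card

theorem mem_twinClass {G : SimpleGraph U} {w w' : U} :
    w' ∈ twinClass G w ↔ ∀ z, G.Adj w z ↔ G.Adj w' z := by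
  simp [twinClass]

/-- The tie-breaker for symmetrization: `u` moves from its twin class into one at least as large,
while other twins remain twins, so the sum of squared class sizes grows. -/
theorem twinCount_lt_clone {G : SimpleGraph U} {u v : U} (hne : v ∉ twinClass G u)
    (hle : (twinClass G u).card ≤ (twinClass G v).card) :
    twinCount G < twinCount (G.comap (cloneMap u v)) := by
  set H := G.comap (cloneMap u v) with hH
  have huv : u ≠ v := fun h => hne (by rw [h, mem_twinClass]; simp)
  have huv' : u ∉ twinClass G v := fun h => hne (by
    rw [mem_twinClass] at h ⊢
    exact fun z => (h z).symm)
  have hadj : ∀ w ≠ u, ∀ z, H.Adj w z ↔ G.Adj w (cloneMap u v z) := fun w hw z => by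
    rw [hH, SimpleGraph.comap_adj, cloneMap_of_ne v hw]
  have hadju : ∀ z, H.Adj u z ↔ G.Adj v (cloneMap u v z) := fun z => by
    rw [hH, SimpleGraph.comap_adj, cloneMap_self]
  have hmem : ∀ w ≠ u, ∀ w' ≠ u, w' ∈ twinClass G w → w' ∈ twinClass H w :=
    fun w hw w' hw' h => by
      rw [mem_twinClass] at h ⊢
      exact fun z => by rw [hadj w hw, hadj w' hw', h]
  -- Summed over `w`, this says that `twinCount` rises by at least 2 plus the difference of the two
  -- class sizes.
  have hpoint : ∀ w, (twinClass G w).card + (if w ∈ twinClass G v then 1 else 0)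
        + (if w = u then 2 else 0)
      ≤ (twinClass H w).card + (if w ∈ twinClass G u then 1 else 0) := fun w => by
    by_cases hw : w = u
    · subst hw
      have hself : w ∈ twinClass G w := by rw [mem_twinClass]; simp
      rw [if_neg huv', if_pos rfl, if_pos hself]
      have hsub : insert w (twinClass G v) ⊆ twinClass H w := by
        intro w' hw'
        rcases Finset.mem_insert.1 hw' with rfl | h
        · rw [mem_twinClass]; simp
        · have hne' : w' ≠ w := fun h' => huv' (h' ▸ h)
          rw [mem_twinClass] at h ⊢
          exact fun z => by rw [hadju, hadj w' hne', h]
      have := Finset.card_le_card hsub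
      rw [Finset.card_insert_of_notMem huv'] at this
      omega
    · rw [if_neg hw, add_zero]
      by_cases hwv : w ∈ twinClass G v
      · have hu' : u ∉ twinClass G w := fun h => huv' (by
          rw [mem_twinClass] at h hwv ⊢
          exact fun z => (hwv z).trans (h z))
        have hsub : insert u (twinClass G w) ⊆ twinClass H w := by
          intro w' hw'
          rcases Finset.mem_insert.1 hw' with rfl | h
          · rw [mem_twinClass] at hwv ⊢
            exact fun z => by rw [hadju, hadj w hw, hwv]
          · exact hmem w hw w' (fun h' => hu' (h' ▸ h)) h
        have := Finset.card_le_card hsub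
        rw [Finset.card_insert_of_notMem hu'] at this
        rw [if_pos hwv]
        omega
      · rw [if_neg hwv, add_zero]
        have hsub : (twinClass G w).erase u ⊆ twinClass H w := fun w' hw' =>
          hmem w hw w' (Finset.ne_of_mem_erase hw') (Finset.mem_of_mem_erase hw')
        have h1 := Finset.card_le_card hsub
        by_cases hwu : w ∈ twinClass G u
        · rw [if_pos hwu]
          have := Finset.pred_card_le_card_erase (s := twinClass G w) (a := u)
          omega
        · rw [if_neg hwu]
          rwa [Finset.erase_eq_of_notMem] at h1
          intro h
          rw [mem_twinClass] at h hwu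
          exact hwu fun z => (h z).symm
  have hsum := Finset.sum_le_sum fun w (_ : w ∈ (Finset.univ : Finset U)) => hpoint w
  simp only [Finset.sum_add_distrib, Finset.sum_ite_mem, Finset.univ_inter, Finset.sum_const,
    smul_eq_mul, mul_one, Finset.sum_ite_eq', Finset.mem_univ, if_true] at hsum
  simp only [twinCount]
  omega

/-- Zykov symmetrization: a complete multipartite graph is induced most often in a complete
multipartite graph. -/
theorem exists_coloring_mapCount_le {F : SimpleGraph V} (hF : F.IsCompleteMultipartite)
    (G : SimpleGraph U) :
    ∃ c : U → U, mapCount F G ≤ mapCount F ((⊤ : SimpleGraph U).comap c) := by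
  -- At a lexicographic maximum both clonings must preserve `mapCount`; non-adjacent vertices that
  -- are not twins would then allow `twinCount` to grow.
  obtain ⟨M, hM⟩ := Finite.exists_max fun G : SimpleGraph U => toLex (mapCount F G, twinCount G)
  have hmax : ∀ H, mapCount F H ≤ mapCount F M := fun H => by
    rcases Prod.Lex.toLex_le_toLex.1 (hM H) with h | h
    · exact h.le
    · exact h.1.le
  have htwin : ∀ H, mapCount F H = mapCount F M → twinCount H ≤ twinCount M := fun H hH => by
    rcases Prod.Lex.toLex_le_toLex.1 (hM H) with h | h
    · exact absurd hH h.ne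
    · exact h.2
  have hclone : ∀ u v, ¬ M.Adj u v → v ∉ twinClass M u →
      ¬ (twinClass M u).card ≤ (twinClass M v).card := fun u v huv hne hle => by
    refine absurd (twinCount_lt_clone hne hle) (not_lt.2 (htwin _ ?_))
    have h1 := two_mul_mapCount_le hF huv
    have h2 := hmax (M.comap (cloneMap u v))
    have h3 := hmax (M.comap (cloneMap v u))
    omega
  have hall : ∀ u v, ¬ M.Adj u v → ∀ z, M.Adj u z ↔ M.Adj v z := fun u v huv => by
    rw [← mem_twinClass]
    by_contra hne
    rcases le_total (twinClass M u).card (twinClass M v).card with h | h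
    · exact hclone u v huv hne h
    · refine hclone v u (fun h' => huv h'.symm) (fun h' => hne ?_) h
      rw [mem_twinClass] at h' ⊢
      exact fun z => (h' z).symm
  have hcm : M.IsCompleteMultipartite := ⟨fun u v w h1 h2 h3 => h2 ((hall u v h1 w).1 h3)⟩
  refine ⟨fun u => (Quotient.mk hcm.setoid u).out, (hmax G).trans (le_of_eq ?_)⟩
  congr 1
  ext u v
  simp only [SimpleGraph.comap_adj, SimpleGraph.top_adj, ne_eq, Quotient.out_inj]
  rw [Quotient.eq]
  change _ ↔ ¬ ¬ M.Adj u v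
  rw [not_not]

end Symmetrization
-- Passage to the limit.
section Limits

variable {V : Type*} [Fintype V]

theorem completeGraph_free_comap_top {U ι : Type*} [Fintype ι] {k : ℕ}
    (hk : Fintype.card ι < k) (c : U → ι) :
    (SimpleGraph.completeGraph (Fin k)).Free ((⊤ : SimpleGraph ι).comap c) := by
  rintro ⟨φ⟩
  obtain ⟨u, v, huv, h⟩ := Fintype.exists_ne_map_eq_of_card_lt
    (fun u => c (φ u)) (by simpa using hk)
  exact φ.toHom.map_adj (show (SimpleGraph.completeGraph (Fin k)).Adj u v from huv) h

theorem partDensity_le_maxDensityCliqueFree {t k n : ℕ} (hk : t < k) {x : Fin t → ℝ}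
    (hx : x ∈ stdSimplex ℝ (Fin t)) (F : SimpleGraph V) (hn : Fintype.card V ≤ n) :
    partDensity F x ≤ maxDensityCliqueFree k F n := by
  obtain ⟨c, hc⟩ := exists_coloring_partDensity_le (U := Fin n) hx F (by simpa using hn)
  refine hc.trans (le_ciSup (f := fun G : {G : SimpleGraph (Fin n) //
    (SimpleGraph.completeGraph (Fin k)).Free G} => inducedDensity F G.1) (Set.finite_range _).bddAbove
    ⟨_, completeGraph_free_comap_top (by simpa using hk) c⟩)

theorem maxDensityCliqueFree_le_maxDensity {k : ℕ} (hk : 2 ≤ k) (F : SimpleGraph V) (n : ℕ) :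
    maxDensityCliqueFree k F n ≤ maxDensity F n := by
  -- Since `k ≥ 2`, the edgeless graph makes the supremum over $K_k$-free graphs one over a nonempty
  -- family.
  have hbot : (SimpleGraph.completeGraph (Fin k)).Free (⊥ : SimpleGraph (Fin n)) := by
    rintro ⟨φ⟩
    exact φ.toHom.map_adj (v := ⟨0, by omega⟩) (w := ⟨1, by omega⟩)
      (show (SimpleGraph.completeGraph (Fin k)).Adj _ _ by simp)
  have : Nonempty {G : SimpleGraph (Fin n) // (SimpleGraph.completeGraph (Fin k)).Free G} :=
    ⟨⟨_, hbot⟩⟩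
  exact ciSup_le fun G => le_ciSup (f := fun G : SimpleGraph (Fin n) => inducedDensity F G)
    (Set.finite_range _).bddAbove G.1

theorem maxDensity_le_mul {F : SimpleGraph V} (hF : F.IsCompleteMultipartite) {D : ℝ} {n : ℕ}
    (hn : 0 < n) (hD : ∀ y ∈ stdSimplex ℝ (Fin n), partDensity F y ≤ D) :
    maxDensity F n ≤ (n : ℝ) ^ Fintype.card V / (n.descFactorial (Fintype.card V) : ℝ) * D := by
  have : Nonempty (Fin n) := ⟨⟨0, hn⟩⟩
  refine ciSup_le fun G => (inducedDensity_le_mapCount F G).trans ?_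
  obtain ⟨c, hc⟩ := exists_coloring_mapCount_le hF G
  obtain ⟨y, hy, hcy⟩ := mapCount_comap_top F c
  rw [Fintype.card_fin] at hcy ⊢
  rw [div_mul_eq_mul_div]
  refine div_le_div_of_nonneg_right ?_ (Nat.cast_nonneg _)
  calc (mapCount F G : ℝ) ≤ mapCount F ((⊤ : SimpleGraph (Fin n)).comap c) := by exact_mod_cast hc
    _ = (n : ℝ) ^ Fintype.card V * partDensity F y := hcy
    _ ≤ (n : ℝ) ^ Fintype.card V * D := mul_le_mul_of_nonneg_left (hD y hy) (by positivity)

theorem tendsto_pow_div_descFactorial (m : ℕ) :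
    Tendsto (fun n : ℕ => (n : ℝ) ^ m / (n.descFactorial m : ℝ)) atTop (𝓝 1) := by
  refine (Asymptotics.isEquivalent_iff_tendsto_one ?_).1 (isEquivalent_descFactorial m).symm
  filter_upwards [eventually_ge_atTop m] with n hn
  exact_mod_cast (Nat.descFactorial_pos.2 hn).ne'

/-- If a partition with `t` parts of positive size is optimal among all finite partitions, then its
density is the limit of both sequences of maximal induced densities. -/
theorem tendsto_maxDensity {F : SimpleGraph V} (hF : F.IsCompleteMultipartite) {t : ℕ} (ht : 0 < t)
    {x : Fin t → ℝ} (hx : x ∈ stdSimplex ℝ (Fin t))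
    (hmax : ∀ n, ∀ y ∈ stdSimplex ℝ (Fin n), partDensity F y ≤ partDensity F x) :
    Tendsto (maxDensity F) atTop (𝓝 (partDensity F x)) ∧
      ∀ k, t < k → Tendsto (maxDensityCliqueFree k F) atTop (𝓝 (partDensity F x)) := by
  have hlim : Tendsto (fun n : ℕ => (n : ℝ) ^ Fintype.card V /
      (n.descFactorial (Fintype.card V) : ℝ) * partDensity F x) atTop (𝓝 (partDensity F x)) := by
    simpa using (tendsto_pow_div_descFactorial (Fintype.card V)).mul_const (partDensity F x)
  have hup : ∀ᶠ n in atTop, maxDensity F n ≤ (n : ℝ) ^ Fintype.card V /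
      (n.descFactorial (Fintype.card V) : ℝ) * partDensity F x := by
    filter_upwards [eventually_gt_atTop 0] with n hn
    exact maxDensity_le_mul hF hn (hmax n)
  have hlow : ∀ k, t < k → ∀ᶠ n in atTop, partDensity F x ≤ maxDensityCliqueFree k F n :=
    fun k hk => by
      filter_upwards [eventually_ge_atTop (Fintype.card V)] with n hn
      exact partDensity_le_maxDensityCliqueFree hk hx F hn
  have hmid : ∀ k, t < k → ∀ n, maxDensityCliqueFree k F n ≤ maxDensity F n := fun k hk n =>
    maxDensityCliqueFree_le_maxDensity (by omega) F n
  constructor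
  · refine tendsto_of_tendsto_of_tendsto_of_le_of_le' tendsto_const_nhds hlim ?_ hup
    filter_upwards [hlow (t + 1) (Nat.lt_succ_self t)] with n hn
    exact hn.trans (hmid _ (Nat.lt_succ_self t) n)
  · intro k hk
    refine tendsto_of_tendsto_of_tendsto_of_le_of_le' tendsto_const_nhds hlim (hlow k hk) ?_
    filter_upwards [hup] with n hn
    exact (hmid k hk n).trans hn

end Limits
end Inducibility

theorem theorem1p8 (r : ℕ) (hr : 2 ≤ r) (a : Fin r → ℕ) (ha : Antitone a)
    (hpos : ∀ i, 1 ≤ a i) (hsing : 1 < a ⟨r - 2, by omega⟩) :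
    (∃ t : ℕ,
      (∀ k : ℕ, t < k → ∃ W : Inducibility.Graphon, W.IsCompletePartite t ∧
        W.AttainsCliqueFree k (Inducibility.completePartite a)) ∧
      (∃ W : Inducibility.Graphon, W.IsCompletePartite t ∧
        W.Attains (Inducibility.completePartite a))) ∧
    ¬ Inducibility.InducibilityDiverse (Inducibility.completePartite a) := by
  open Inducibility in
  -- The zero-based index `r - 2` is that of $a_{r-1}$. Of two distinct indices one is at most `r -
  -- 2`, so its part has at least $a_{r-1}$ vertices, and the other part has at least one.
  have hpair : ∀ l l' : Fin r, l ≠ l' → a ⟨r - 2, by omega⟩ + 1 ≤ a l + a l' := by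
    have hle : ∀ l : Fin r, (l : ℕ) ≤ r - 2 → a ⟨r - 2, by omega⟩ ≤ a l := fun l hl => ha hl
    intro l l' hne
    have hne' : (l : ℕ) ≠ l' := fun h => hne (Fin.ext h)
    have h1 := hpos l
    have h2 := hpos l'
    rcases Nat.lt_or_ge (r - 2) l with h | h
    · have := hle l' (by omega)
      omega
    · have := hle l h
      omega
  obtain ⟨t, x, hx, hx0, hmax⟩ := exists_optimal_partition hpos hsing hpair
  have ht : 0 < t := by
    rcases Nat.eq_zero_or_pos t with rfl | h
    · simpa using hx.2
    · exact h
  obtain ⟨hlim, hlimk⟩ := tendsto_maxDensity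
    (SimpleGraph.completeMultipartiteGraph.isCompleteMultipartite fun i => Fin (a i)) ht hx
    fun n y hy => partDensity_le_of_injSum_le hpos (hmax n y hy)
  have hW := density_completePartiteGraphon ht hx (completePartite a)
  have hpart : (completePartiteGraphon x).IsCompletePartite t := ⟨x, hx, hx0, rfl⟩
  refine ⟨⟨t, fun k hk => ⟨_, hpart, completePartiteGraphon_isFree ht x hk, ?_⟩, _, hpart, ?_⟩, ?_⟩
  · rw [hW]
    exact hlimk k hk
  · rw [Graphon.Attains, hW]
    exact hlim
  · intro hdiv
    -- From `t + 1` on, all the clique-free inducibilities equal the same limit.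
    obtain ⟨m, hm, hlt⟩ := hdiv (t + 1)
    refine absurd hlt (not_lt.2 (le_of_eq ?_))
    rw [cliqueFreeInducibility, cliqueFreeInducibility]
    exact (hlimk m (by omega)).limUnder_eq.trans (hlimk (t + 1) (by omega)).limUnder_eq.symm
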